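/- For a self-map $f$ of $[-1,1]$ and $n\ge 1$ let $\mathrm{Per}(f,n)$ be the set of periodic points of $f$ in $[-1,1]$ whose least period is $n$. A $C^\infty$ self-map $f:[-1,1]\to[-1,1]$ is called unimodal if $f(-1)=f(1)=-1$ and there is a point $c\in(-1,1)$ such that $f$ is strictly increasing on $[-1,c]$, strictly decreasing on $[c,1]$, and $c$ is the unique critical point of $f$, i.e. $f'(x)=0$ if and only if $x=c$. A periodic point $x$ of $f$ of least period $n$ is hyperbolic if $|(f^n)'(x)|\neq 1$. (Derivatives at $\pm1$ are one-sided.) Let $(\gamma_n)_{n\ge1}$ be a sequence of positive integers. Then there exists a $C^\infty$ unimodal self-map $f$ of $[-1,1]$ such that all periodic points of $f$ are hyperbolic and $\#\mathrm{Per}(f,n)\ge\gamma_n$ for every $n\ge2$. -/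

import Mathlib

open Set Function
open scoped ContDiff

/-- `f` restricts to a `C^∞` unimodal self-map of `[-1,1]`. Only the values of `f` on `[-1,1]`
matter. The map sends the boundary into the boundary, and it has a unique critical point `c`,
lying in the interior: `f` is strictly increasing to the left of `c` and strictly decreasing to
the right of `c`, and `c` is the only zero of the derivative (one-sided at `-1` and at `1`). -/
structure IsSmoothUnimodal (f : ℝ → ℝ) : Prop where
  contDiffOn : ContDiffOn ℝ ∞ f (Icc (-1) 1)
  mapsTo : MapsTo f (Icc (-1) 1) (Icc (-1) 1)
  map_neg_one : f (-1) = -1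
  map_one : f 1 = -1
  exists_critical : ∃ c ∈ Ioo (-1 : ℝ) 1,
    StrictMonoOn f (Icc (-1) c) ∧ StrictAntiOn f (Icc c 1) ∧
      ∀ x ∈ Icc (-1 : ℝ) 1, derivWithin f (Icc (-1) 1) x = 0 ↔ x = c

/-- The set `Per(f,n)` of the points of `[-1,1]` that are periodic under `f` with least period
`n` (for `n ≥ 1`; it is empty for `n = 0`). -/
def perSet (f : ℝ → ℝ) (n : ℕ) : Set ℝ :=
  {x | x ∈ Icc (-1 : ℝ) 1 ∧ x ∈ periodicPts f ∧ minimalPeriod f x = n}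

/-- A periodic point `x ∈ [-1,1]` of a self-map `f` of `[-1,1]` with least period `n` is
hyperbolic if its multiplier `(fⁿ)'(x)` does not have absolute value one. The derivative is
that of the `n`-th iterate on `[-1,1]`, hence one-sided at `-1` and at `1`. -/
def IsHyperbolicPeriodicPt (f : ℝ → ℝ) (x : ℝ) : Prop :=
  x ∈ periodicPts f ∧ |derivWithin (f^[minimalPeriod f x]) (Icc (-1) 1) x| ≠ 1

/-! The map is `f(x) = 1 - φ(|x|)`, where `φ` is flat at `0` and `φ(x) = 2x` for `x ≥ 3/8`. Thus `f`
is the expanding tent `1 - 2|x|` away from the critical point, and all the freedom lies in `|x| <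
3/8`. A point there with `2^j φ(|x|) ∈ (5/8, 5/4]` follows the tent and first returns after `j + 1`
steps, with multiplier `2^j φ'(|x|)`; for `j ≥ 1` it returns to `2^j φ(|x|) - 1`
(`orbit_until_return`).

Disjoint intervals ("cores") accumulate at `0`. On core `i ≥ 2`, `2^i φ(x) = 1 + x + δ P(x - c)`,
with `P` an odd polynomial having `2N + 1` simple roots in the core. So `f^(i+1)` is there the
increasing map `x + δ P(x - c)`, whose fixed points have least period `i + 1`. On core `1`, centred
at the fixed point `1/3`, `f` is such a map followed by the reflection `x ↦ 2/3 - x`, and the roots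
other than the centre have period `2`. The scale `2^(-i)` makes the glued `φ` smooth at `0`, with no
limit on the numbers `N i`.

Hyperbolicity has three cases (`absMultiplier_ne_one`). An orbit avoiding `|x| < 3/8` has multiplier
`2^n`. An orbit meeting a core up to sign lands in that core, where monotonicity of the return map
reduces it to a fixed point, whose multiplier is not `1` because the roots are simple. Any other
orbit splits into first returns, each with multiplier greater than `1`; this last bound, the field
`one_lt_deriv`, is the main estimate of `exists_isProfile`. -/

/-! ### Derivative estimates for the smooth transition function. -/

namespace Real.smoothTransition

theorem hasDerivAt (x : ℝ) :
    HasDerivAt Real.smoothTransition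
      (expNegInvGlue x * expNegInvGlue (1 - x) * (x⁻¹ ^ 2 + (1 - x)⁻¹ ^ 2) /
        (expNegInvGlue x + expNegInvGlue (1 - x)) ^ 2) x := by
  have hE : ∀ y : ℝ, HasDerivAt expNegInvGlue (y⁻¹ ^ 2 * expNegInvGlue y) y := fun y => by
    simpa using expNegInvGlue.hasDerivAt_polynomial_eval_inv_mul 1 y
  have h1 := (hE (1 - x)).comp x ((hasDerivAt_id x).const_sub 1)
  have h := (hE x).div ((hE x).add h1) (pos_denom x).ne'
  refine h.congr_deriv ?_
  simp only [Pi.add_apply, Function.comp_apply]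
  congr 1
  ring

/-- On `(0, 1)` the derivative is `S (1 - S) (x⁻² + (1 - x)⁻²)`, and `x (1 - x) ≤ 1/4` makes the
last factor at least `8`. This forces a steep rise wherever a transition is neither just begun nor
almost complete. -/
theorem le_deriv (x : ℝ) :
    8 * Real.smoothTransition x * (1 - Real.smoothTransition x) ≤
      deriv Real.smoothTransition x := by
  rw [(hasDerivAt x).deriv]
  have hD := pos_denom x
  have hS : 8 * Real.smoothTransition x * (1 - Real.smoothTransition x) =
      expNegInvGlue x * expNegInvGlue (1 - x) * 8 /
        (expNegInvGlue x + expNegInvGlue (1 - x)) ^ 2 := by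
    unfold Real.smoothTransition
    field_simp
    ring
  rw [hS]
  rcases le_or_gt x 0 with h0 | h0
  · simp [expNegInvGlue.zero_of_nonpos h0]
  rcases le_or_gt 1 x with h1 | h1
  · simp [expNegInvGlue.zero_of_nonpos (sub_nonpos.2 h1)]
  have h1' : 0 < 1 - x := sub_pos.2 h1
  gcongr ?_ * ?_ / _
  · exact mul_nonneg (expNegInvGlue.nonneg _) (expNegInvGlue.nonneg _)
  have ha : x * x⁻¹ = 1 := mul_inv_cancel₀ h0.ne'
  have hb : (1 - x) * (1 - x)⁻¹ = 1 := mul_inv_cancel₀ h1'.ne'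
  have hc : 4 * (x * (1 - x)) ≤ 1 := by nlinarith [sq_nonneg (2 * x - 1)]
  have hp : 0 < x⁻¹ * (1 - x)⁻¹ := by positivity
  have hd : 4 ≤ x⁻¹ * (1 - x)⁻¹ := by
    have : x⁻¹ * (1 - x)⁻¹ * (x * (1 - x)) = 1 := by
      linear_combination (x⁻¹ * x) * hb + ha
    nlinarith
  nlinarith [sq_nonneg (x⁻¹ - (1 - x)⁻¹)]

theorem deriv_nonneg (x : ℝ) : 0 ≤ deriv Real.smoothTransition x :=
  Real.smoothTransition.monotone.deriv_nonneg

theorem deriv_eq_zero {x : ℝ} (h : x ≤ 0 ∨ 1 ≤ x) : deriv Real.smoothTransition x = 0 := by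
  rw [(hasDerivAt x).deriv]
  rcases h with h | h
  · simp [expNegInvGlue.zero_of_nonpos h]
  · simp [expNegInvGlue.zero_of_nonpos (sub_nonpos.2 h)]

theorem exists_bound_iteratedDeriv (k : ℕ) :
    ∃ C : ℝ, 0 ≤ C ∧ ∀ x, |iteratedDeriv k Real.smoothTransition x| ≤ C := by
  have hc : Continuous (iteratedDeriv k Real.smoothTransition) :=
    (Real.smoothTransition.contDiff (n := (k : ℕ∞))).continuous_iteratedDeriv k le_rfl
  obtain ⟨C, hC⟩ := (isCompact_Icc (a := (-1 : ℝ)) (b := 2)).exists_bound_of_continuousOn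
    hc.continuousOn
  have hC0 : 0 ≤ C := (norm_nonneg _).trans (hC 0 (by norm_num))
  refine ⟨C, hC0, fun x => ?_⟩
  -- Outside `[-1, 2]` the function has the same constant germ as at the endpoint `-1` or `2`, so
  -- the compact bound applies there too.
  have key : ∀ {y c : ℝ}, y ∈ Icc (-1 : ℝ) 2 →
      Real.smoothTransition =ᶠ[nhds x] (fun _ => c) →
      Real.smoothTransition =ᶠ[nhds y] (fun _ => c) →
      |iteratedDeriv k Real.smoothTransition x| ≤ C := by
    intro y c hy hx hxy
    have h := hC y hy
    rw [hxy.iteratedDeriv_eq] at h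
    rw [hx.iteratedDeriv_eq]
    simpa [iteratedDeriv_const] using h
  rcases lt_or_ge x (-1) with h1 | h1
  · refine key (y := -1) (c := 0) (by norm_num) ?_ ?_
    · filter_upwards [Iio_mem_nhds (h1.trans (by norm_num : (-1 : ℝ) < 0))] with z hz
      exact zero_of_nonpos (le_of_lt hz)
    · filter_upwards [Iio_mem_nhds (by norm_num : (-1 : ℝ) < 0)] with z hz
      exact zero_of_nonpos (le_of_lt hz)
  rcases le_or_gt x 2 with h2 | h2
  · exact hC x ⟨h1, h2⟩
  · refine key (y := 2) (c := 1) (by norm_num) ?_ ?_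
    · filter_upwards [Ioi_mem_nhds ((by norm_num : (1 : ℝ) < 2).trans h2)] with z hz
      exact one_of_one_le (le_of_lt hz)
    · filter_upwards [Ioi_mem_nhds (by norm_num : (1 : ℝ) < 2)] with z hz
      exact one_of_one_le (le_of_lt hz)

end Real.smoothTransition

/-! ### The oscillating polynomial. -/

/-- The odd polynomial `u ∏_{j=1}^N (u² - (jh)²)`, whose roots are `jh` for `|j| ≤ N`. -/
def oscPoly (h : ℝ) : ℕ → ℝ → ℝ
  | 0, u => u
  | N + 1, u => oscPoly h N u * (u ^ 2 - ((N + 1) * h) ^ 2)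

/-- The derivative of `oscPoly`. -/
def oscPolyDeriv (h : ℝ) : ℕ → ℝ → ℝ
  | 0, _ => 1
  | N + 1, u =>
      oscPolyDeriv h N u * (u ^ 2 - ((N + 1) * h) ^ 2) + oscPoly h N u * (2 * u)

theorem hasDerivAt_oscPoly (h : ℝ) (N : ℕ) (u : ℝ) :
    HasDerivAt (oscPoly h N) (oscPolyDeriv h N u) u := by
  induction N with
  | zero => exact hasDerivAt_id u
  | succ N ih =>
    refine (ih.mul (((hasDerivAt_id u).pow 2).sub_const (((N + 1) * h) ^ 2))).congr_deriv ?_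
    simp [oscPolyDeriv]

theorem contDiff_oscPoly (h : ℝ) (N : ℕ) : ContDiff ℝ ∞ (oscPoly h N) := by
  induction N with
  | zero => exact contDiff_id
  | succ N ih => exact ih.mul ((contDiff_id.pow 2).sub contDiff_const)

theorem continuous_oscPolyDeriv (h : ℝ) (N : ℕ) : Continuous (oscPolyDeriv h N) := by
  have : oscPolyDeriv h N = deriv (oscPoly h N) :=
    funext fun u => (hasDerivAt_oscPoly h N u).deriv.symm
  rw [this]
  exact (contDiff_oscPoly h N).continuous_deriv (by simp)

theorem oscPoly_neg (h : ℝ) (N : ℕ) (u : ℝ) : oscPoly h N (-u) = -oscPoly h N u := by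
  induction N with
  | zero => rfl
  | succ N ih => simp [oscPoly, ih]

theorem oscPolyDeriv_neg (h : ℝ) (N : ℕ) (u : ℝ) :
    oscPolyDeriv h N (-u) = oscPolyDeriv h N u := by
  induction N with
  | zero => rfl
  | succ N ih => simp [oscPolyDeriv, ih, oscPoly_neg]

theorem oscPoly_natCast_mul (h : ℝ) {N j : ℕ} (hj : j ≤ N) : oscPoly h N (j * h) = 0 := by
  induction N with
  | zero => simp [oscPoly, Nat.le_zero.1 hj]
  | succ N ih =>
    rcases Nat.le_succ_iff.1 hj with hj | rfl
    · simp [oscPoly, ih hj]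
    · simp [oscPoly]

theorem mul_oscPoly_pos {h : ℝ} (hh : 0 < h) {N : ℕ} {u : ℝ} (hu : N * h < |u|) :
    0 < u * oscPoly h N u := by
  induction N with
  | zero =>
    have : u ≠ 0 := by simpa using hu
    simpa [oscPoly] using mul_self_pos.2 this
  | succ N ih =>
    push_cast at hu
    have h1 : ((N + 1) * h) ^ 2 < u ^ 2 := by
      rw [← sq_abs u]; gcongr
    have := mul_pos (ih (by linarith)) (sub_pos.2 h1)
    simpa [oscPoly, mul_assoc] using this

/-- In the product rule both terms are nonnegative beyond the largest root. Hence the perturbation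
only increases slopes off its core. -/
theorem oscPolyDeriv_pos {h : ℝ} (hh : 0 < h) {N : ℕ} {u : ℝ} (hu : N * h ≤ |u|) :
    0 < oscPolyDeriv h N u := by
  induction N with
  | zero => simp [oscPolyDeriv]
  | succ N ih =>
    push_cast at hu
    have h1 : ((N + 1) * h) ^ 2 ≤ u ^ 2 := by
      rw [← sq_abs u]; gcongr
    have h2 := mul_oscPoly_pos hh (N := N) (u := u) (by linarith)
    have h3 := mul_nonneg (ih (by linarith)).le (sub_nonneg.2 h1)
    simp only [oscPolyDeriv]
    linarith

/-- The roots are simple; this is the source of hyperbolicity in the cores. -/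
theorem oscPolyDeriv_ne_zero {h : ℝ} (hh : 0 < h) {N : ℕ} {u : ℝ} (hu : oscPoly h N u = 0) :
    oscPolyDeriv h N u ≠ 0 := by
  induction N with
  | zero => simp [oscPolyDeriv]
  | succ N ih =>
    by_cases h1 : u ^ 2 - ((N + 1) * h) ^ 2 = 0
    · have h2 : |u| = (N + 1) * h := by
        rw [← abs_of_pos (by positivity : 0 < (N + 1) * h)]
        exact (sq_eq_sq_iff_abs_eq_abs _ _).1 (sub_eq_zero.1 h1)
      exact (oscPolyDeriv_pos hh (by push_cast; exact h2.ge)).ne'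
    · have h2 : oscPoly h N u = 0 := (mul_eq_zero.1 hu).resolve_right h1
      simpa [oscPolyDeriv, h2] using ⟨ih h2, h1⟩

/-! ### A partition of unity on `(0, ∞)` with transitions accumulating at `0`. -/

namespace UnimodalProfile

/-- The right end of the `i`-th transition interval. -/
noncomputable def stepEnd (i : ℕ) : ℝ := if i = 0 then 3 / 8 else 1 / (4 * (i + 1))

/-- The left end of the `i`-th transition interval. -/
noncomputable def stepStart (i : ℕ) : ℝ :=
  if i = 0 then 17 / 48 else (stepEnd (i + 1) + stepEnd i) / 2

/-- A smooth step from `0` to `1` across the `i`-th transition interval. -/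
noncomputable def step (i : ℕ) (x : ℝ) : ℝ :=
  Real.smoothTransition ((stepEnd i - stepStart i)⁻¹ * (x - stepStart i))

/-- The partition of unity on `(0, ∞)` that belongs to the steps. -/
noncomputable def window : ℕ → ℝ → ℝ
  | 0, x => step 0 x
  | i + 1, x => step (i + 1) x - step i x

/-- The centre of the `i`-th core. -/
noncomputable def coreCenter : ℕ → ℝ
  | 0 => 0
  | 1 => 1 / 3
  | i + 2 => (stepEnd (i + 2) + stepStart (i + 1)) / 2

/-- The radius of the `i`-th core. -/
noncomputable def coreRadius : ℕ → ℝ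
  | 0 => 1
  | 1 => 1 / 96
  | i + 2 => (stepStart (i + 1) - stepEnd (i + 2)) / 4

/-- The slope of the unperturbed profile on the `i`-th plateau. -/
noncomputable def plateauSlope : ℕ → ℝ
  | 0 => 2
  | 1 => 2
  | _ + 2 => 1

/-- The offset of the unperturbed profile on the `i`-th plateau. -/
noncomputable def plateauOffset : ℕ → ℝ
  | 0 => 0
  | 1 => 1 / 3
  | _ + 2 => 1

theorem stepEnd_zero : stepEnd 0 = 3 / 8 := rfl

theorem stepStart_zero : stepStart 0 = 17 / 48 := rfl

theorem stepEnd_succ (i : ℕ) : stepEnd (i + 1) = 1 / (4 * (i + 2)) := by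
  simp only [stepEnd, Nat.succ_ne_zero, if_false]
  push_cast
  ring_nf

theorem stepStart_succ (i : ℕ) :
    stepStart (i + 1) = (stepEnd (i + 2) + stepEnd (i + 1)) / 2 := rfl

theorem stepEnd_pos (i : ℕ) : 0 < stepEnd i := by
  unfold stepEnd; split_ifs <;> positivity

theorem stepEnd_one : stepEnd 1 = 1 / 8 := by rw [stepEnd_succ]; norm_num

theorem stepEnd_succ_lt_of_pos (i : ℕ) : stepEnd (i + 2) < stepEnd (i + 1) := by
  rw [stepEnd_succ, stepEnd_succ]
  apply one_div_lt_one_div_of_lt <;> push_cast <;> first | positivity | linarith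

theorem stepEnd_succ_lt_stepStart (i : ℕ) : stepEnd (i + 1) < stepStart i := by
  rcases i with _ | i
  · rw [stepEnd_one, stepStart_zero]; norm_num
  · rw [stepStart_succ]; linarith [stepEnd_succ_lt_of_pos i]

theorem stepStart_lt_stepEnd (i : ℕ) : stepStart i < stepEnd i := by
  rcases i with _ | i
  · rw [stepEnd_zero, stepStart_zero]; norm_num
  · rw [stepStart_succ]; linarith [stepEnd_succ_lt_of_pos i]

theorem stepStart_pos (i : ℕ) : 0 < stepStart i :=
  (stepEnd_pos (i + 1)).trans (stepEnd_succ_lt_stepStart i)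

theorem stepEnd_strictAnti : StrictAnti stepEnd :=
  strictAnti_nat_of_succ_lt fun i => (stepEnd_succ_lt_stepStart i).trans (stepStart_lt_stepEnd i)

theorem stepStart_strictAnti : StrictAnti stepStart :=
  strictAnti_nat_of_succ_lt fun i => (stepStart_lt_stepEnd _).trans (stepEnd_succ_lt_stepStart i)

theorem stepEnd_le_of_ne_zero {i : ℕ} (hi : i ≠ 0) : stepEnd i ≤ 1 / 8 := by
  rw [← stepEnd_one]
  exact stepEnd_strictAnti.antitone (Nat.one_le_iff_ne_zero.2 hi)

theorem exists_stepEnd_lt {x : ℝ} (hx : 0 < x) : ∃ i, stepEnd i < x := by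
  obtain ⟨n, hn⟩ := exists_nat_gt (1 / x)
  refine ⟨n + 1, ?_⟩
  rw [stepEnd_succ, div_lt_iff₀ (by positivity)]
  rw [div_lt_iff₀ hx] at hn
  nlinarith

theorem exists_mem_Ioc_stepEnd {x : ℝ} (hx : 0 < x) (hx' : x ≤ 3 / 8) :
    ∃ i, stepEnd (i + 1) < x ∧ x ≤ stepEnd i := by
  classical
  have h := exists_stepEnd_lt hx
  rcases hk : Nat.find h with _ | i
  · have := Nat.find_spec h
    rw [hk, stepEnd_zero] at this
    linarith
  · refine ⟨i, hk ▸ Nat.find_spec h, not_lt.1 (Nat.find_min h (m := i) (by omega))⟩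

/-- Transitions shrink only quadratically in `i`, so the `k`-th derivatives of the windows grow
polynomially and the weights `2^(-i)` absorb them. -/
theorem inv_length_le (i : ℕ) : (stepEnd i - stepStart i)⁻¹ ≤ 48 * ((i : ℝ) + 1) ^ 2 := by
  rcases i with _ | i
  · rw [stepEnd_zero, stepStart_zero]; norm_num
  · rw [stepStart_succ, stepEnd_succ, stepEnd_succ]
    have : (1 / (4 * ((i : ℝ) + 2)) - (1 / (4 * (((i + 1 : ℕ) : ℝ) + 2)) +
        1 / (4 * ((i : ℝ) + 2))) / 2) = (8 * (((i : ℝ) + 2) * (i + 3)))⁻¹ := by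
      push_cast
      field_simp
      ring
    rw [this, inv_inv]
    push_cast
    nlinarith [(Nat.cast_nonneg i : (0 : ℝ) ≤ i)]

theorem le_inv_length {i : ℕ} : 8 ≤ (stepEnd i - stepStart i)⁻¹ := by
  have h0 := stepStart_lt_stepEnd i
  rw [le_inv_comm₀ (by norm_num) (sub_pos.2 h0)]
  rcases i with _ | i
  · rw [stepEnd_zero, stepStart_zero]; norm_num
  · linarith [stepEnd_le_of_ne_zero (Nat.succ_ne_zero i), stepStart_pos (i + 1)]

theorem step_eq_zero {i : ℕ} {x : ℝ} (hx : x ≤ stepStart i) : step i x = 0 := by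
  refine Real.smoothTransition.zero_of_nonpos (mul_nonpos_of_nonneg_of_nonpos ?_ (by linarith))
  linarith [le_inv_length (i := i)]

theorem step_eq_one {i : ℕ} {x : ℝ} (hx : stepEnd i ≤ x) : step i x = 1 := by
  refine Real.smoothTransition.one_of_one_le ?_
  rw [← div_eq_inv_mul, one_le_div (by linarith [stepStart_lt_stepEnd i])]
  linarith

theorem contDiff_step (i : ℕ) : ContDiff ℝ ∞ (step i) :=
  Real.smoothTransition.contDiff.comp (contDiff_const.mul (contDiff_id.sub contDiff_const))

theorem contDiff_window (i : ℕ) : ContDiff ℝ ∞ (window i) := by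
  rcases i with _ | i
  · exact contDiff_step 0
  · exact (contDiff_step _).sub (contDiff_step i)

theorem step_nonneg (i : ℕ) (x : ℝ) : 0 ≤ step i x := Real.smoothTransition.nonneg _

theorem step_le_one (i : ℕ) (x : ℝ) : step i x ≤ 1 := Real.smoothTransition.le_one _

/-- The derivative of `step`. -/
noncomputable def stepDeriv (i : ℕ) (x : ℝ) : ℝ :=
  deriv Real.smoothTransition ((stepEnd i - stepStart i)⁻¹ * (x - stepStart i)) *
    (stepEnd i - stepStart i)⁻¹

theorem hasDerivAt_step (i : ℕ) (x : ℝ) : HasDerivAt (step i) (stepDeriv i x) x := by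
  have h1 : HasDerivAt (fun x => (stepEnd i - stepStart i)⁻¹ * (x - stepStart i))
      (stepEnd i - stepStart i)⁻¹ x := by
    simpa using ((hasDerivAt_id x).sub_const (stepStart i)).const_mul (stepEnd i - stepStart i)⁻¹
  have h2 := (Real.smoothTransition.hasDerivAt
    ((stepEnd i - stepStart i)⁻¹ * (x - stepStart i))).differentiableAt.hasDerivAt
  exact h2.comp x h1

/-- The factor `64` is `8` from `le_deriv` times `8` from `le_inv_length`. -/
theorem le_stepDeriv (i : ℕ) (x : ℝ) : 64 * step i x * (1 - step i x) ≤ stepDeriv i x := by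
  have h1 := Real.smoothTransition.le_deriv ((stepEnd i - stepStart i)⁻¹ * (x - stepStart i))
  have h2 := le_inv_length (i := i)
  have h3 := mul_nonneg (step_nonneg i x) (sub_nonneg.2 (step_le_one i x))
  change 8 * step i x * (1 - step i x) ≤ _ at h1
  unfold stepDeriv
  nlinarith

theorem stepDeriv_nonneg (i : ℕ) (x : ℝ) : 0 ≤ stepDeriv i x :=
  mul_nonneg (Real.smoothTransition.deriv_nonneg _) (by linarith [le_inv_length (i := i)])

theorem stepDeriv_eq_zero_of_le {i : ℕ} {x : ℝ} (hx : x ≤ stepStart i) : stepDeriv i x = 0 := by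
  rw [stepDeriv, Real.smoothTransition.deriv_eq_zero (Or.inl _), zero_mul]
  exact mul_nonpos_of_nonneg_of_nonpos (by linarith [le_inv_length (i := i)]) (by linarith)

theorem norm_iteratedFDeriv_step_le {k : ℕ} {C : ℝ}
    (hC : ∀ x, |iteratedDeriv k Real.smoothTransition x| ≤ C) (i : ℕ) (x : ℝ) :
    ‖iteratedFDeriv ℝ k (step i) x‖ ≤ C * (48 * ((i : ℝ) + 1) ^ 2) ^ k := by
  have h0 : 0 ≤ (stepEnd i - stepStart i)⁻¹ := by linarith [le_inv_length (i := i)]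
  rw [norm_iteratedFDeriv_eq_norm_iteratedDeriv]
  have h1 : iteratedDeriv k (step i) x = (stepEnd i - stepStart i)⁻¹ ^ k *
      iteratedDeriv k Real.smoothTransition
        ((stepEnd i - stepStart i)⁻¹ * (x - stepStart i)) := by
    have h2 := iteratedDeriv_comp_sub_const k
      (fun y => Real.smoothTransition ((stepEnd i - stepStart i)⁻¹ * y)) (stepStart i)
    have h3 := iteratedDeriv_comp_const_mul
      (Real.smoothTransition.contDiff (n := (k : ℕ∞))) (stepEnd i - stepStart i)⁻¹
    rw [h3] at h2
    exact congrFun h2 x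
  rw [h1, norm_mul, norm_pow, Real.norm_of_nonneg h0, Real.norm_eq_abs, mul_comm]
  have := abs_nonneg (iteratedDeriv k Real.smoothTransition
        ((stepEnd i - stepStart i)⁻¹ * (x - stepStart i)))
  gcongr
  · exact this.trans (hC _)
  · exact hC _
  · exact inv_length_le i

theorem norm_iteratedFDeriv_window_le {k : ℕ} {C : ℝ}
    (hC : ∀ x, |iteratedDeriv k Real.smoothTransition x| ≤ C) (i : ℕ) (x : ℝ) :
    ‖iteratedFDeriv ℝ k (window i) x‖ ≤ 2 * C * (48 * ((i : ℝ) + 1) ^ 2) ^ k := by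
  have hC0 : 0 ≤ C := (abs_nonneg _).trans (hC 0)
  rcases i with _ | i
  · refine (norm_iteratedFDeriv_step_le hC 0 x).trans ?_
    gcongr
    linarith
  · have h1 := norm_iteratedFDeriv_step_le hC (i + 1) x
    have h2 := norm_iteratedFDeriv_step_le hC i x
    have h3 : C * (48 * ((i : ℝ) + 1) ^ 2) ^ k ≤ C * (48 * (((i + 1 : ℕ) : ℝ) + 1) ^ 2) ^ k := by
      push_cast
      gcongr
      linarith
    have hs : ∀ j, ContDiffAt ℝ k (step j) x := fun j =>
      ((contDiff_step j).of_le (mod_cast le_top)).contDiffAt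
    have h4 : iteratedFDeriv ℝ k (window (i + 1)) x =
        iteratedFDeriv ℝ k (step (i + 1)) x - iteratedFDeriv ℝ k (step i) x :=
      iteratedFDeriv_sub_apply (hs _) (hs _)
    rw [h4]
    refine (norm_sub_le _ _).trans ?_
    linarith

theorem summable_window_bound (C : ℝ) (k : ℕ) :
    Summable fun i : ℕ => (1 / 2 : ℝ) ^ i * (2 * C * (48 * ((i : ℝ) + 1) ^ 2) ^ k) := by
  have h := summable_pow_mul_geometric_of_norm_lt_one (R := ℝ) (2 * k) (r := 1 / 2)
    (by norm_num)
  have h2 := ((summable_nat_add_iff 1).2 h).mul_left (2 * (2 * C * 48 ^ k))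
  refine h2.congr fun i => ?_
  push_cast
  rw [mul_pow 48, ← pow_mul, pow_succ]
  ring

theorem contDiff_tsum_window :
    ContDiff ℝ ∞ fun x => ∑' i, (1 / 2 : ℝ) ^ i * window i x := by
  choose C hC0 hC using Real.smoothTransition.exists_bound_iteratedDeriv
  refine contDiff_tsum (v := fun (k i : ℕ) => (1 / 2 : ℝ) ^ i *
    (2 * C k * (48 * ((i : ℝ) + 1) ^ 2) ^ k)) (fun i => contDiff_const.mul (contDiff_window i))
    (fun k _ => summable_window_bound (C k) k) fun k i x _ => ?_
  have h : iteratedFDeriv ℝ k (fun x => (1 / 2 : ℝ) ^ i * window i x) x =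
      (1 / 2 : ℝ) ^ i • iteratedFDeriv ℝ k (window i) x :=
    iteratedFDeriv_const_smul_apply (a := (1 / 2 : ℝ) ^ i)
      ((contDiff_window i).of_le (mod_cast le_top)).contDiffAt
  rw [h, norm_smul, Real.norm_of_nonneg (by positivity)]
  gcongr
  exact norm_iteratedFDeriv_window_le (hC k) i x

theorem hasCompactSupport_window (i : ℕ) : HasCompactSupport (window (i + 1)) := by
  refine HasCompactSupport.intro (isCompact_Icc (a := (0 : ℝ)) (b := 1)) fun x hx => ?_
  rcases lt_or_ge x 0 with h | h
  · rw [window, step_eq_zero (h.le.trans (stepStart_pos _).le),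
      step_eq_zero (h.le.trans (stepStart_pos _).le), sub_zero]
  · have h1 : 1 < x := by
      by_contra h1
      exact hx ⟨h, not_lt.1 h1⟩
    have h2 : ∀ j, stepEnd j ≤ x := fun j => by
      have := stepEnd_strictAnti.antitone (Nat.zero_le j)
      rw [stepEnd_zero] at this
      linarith
    rw [window, step_eq_one (h2 _), step_eq_one (h2 _), sub_self]

/-- Only finitely many bounded quantities have to be controlled: two functions on `[0, 1]` and the
first `n` derivatives of a compactly supported function. -/
theorem exists_small_factor {w w' g : ℝ → ℝ} (hw : Continuous w) (hw' : Continuous w')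
    (hg : ContDiff ℝ ∞ g) (hc : HasCompactSupport g) (n : ℕ) :
    ∃ δ : ℝ, 0 < δ ∧ (∀ x ∈ Icc (0 : ℝ) 1, |δ * w x| ≤ 1 / 96 ∧ |δ * w' x| ≤ 1 / 2) ∧
      ∀ k ≤ n, ∀ x, δ * ‖iteratedFDeriv ℝ k g x‖ ≤ 1 := by
  obtain ⟨A, hA⟩ := (isCompact_Icc (a := (0 : ℝ)) (b := 1)).exists_bound_of_continuousOn
    hw.continuousOn
  obtain ⟨B, hB⟩ := (isCompact_Icc (a := (0 : ℝ)) (b := 1)).exists_bound_of_continuousOn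
    hw'.continuousOn
  have hM : ∀ k : ℕ, ∃ M, ∀ x, ‖iteratedFDeriv ℝ k g x‖ ≤ M := fun k =>
    (hc.iteratedFDeriv k).exists_bound_of_continuous
      (hg.continuous_iteratedFDeriv (m := k) (mod_cast le_top))
  choose M hM using hM
  have hA0 : 0 ≤ A := (norm_nonneg _).trans (hA 0 (by norm_num))
  have hB0 : 0 ≤ B := (norm_nonneg _).trans (hB 0 (by norm_num))
  have hM0 : ∀ k, 0 ≤ M k := fun k => (norm_nonneg _).trans (hM k 0)
  have hS0 : 0 ≤ ∑ k ∈ Finset.range (n + 1), M k := Finset.sum_nonneg fun k _ => hM0 k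
  set T := 1 + A + B + ∑ k ∈ Finset.range (n + 1), M k with hT
  have hT0 : 0 < T := by positivity
  refine ⟨1 / (96 * T), by positivity, fun x hx => ⟨?_, ?_⟩, fun k hk x => ?_⟩
  · have := hA x hx
    rw [Real.norm_eq_abs] at this
    rw [abs_mul, abs_of_pos (by positivity), div_mul_eq_mul_div, div_le_div_iff₀ (by positivity)
      (by norm_num)]
    linarith
  · have := hB x hx
    rw [Real.norm_eq_abs] at this
    rw [abs_mul, abs_of_pos (by positivity), div_mul_eq_mul_div, div_le_div_iff₀ (by positivity)
      (by norm_num)]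
    linarith
  · have h1 := hM k x
    have h2 := Finset.single_le_sum (f := M) (fun k _ => hM0 k)
      (Finset.mem_range.2 (Nat.lt_succ_of_le hk))
    rw [div_mul_eq_mul_div, div_le_one (by positivity)]
    linarith

theorem window_eq_zero_of_nonpos {x : ℝ} (hx : x ≤ 0) (i : ℕ) : window i x = 0 := by
  rcases i with _ | i <;> simp [window, step_eq_zero (hx.trans (stepStart_pos _).le)]

/-- The domain on which only the windows `i` and `i + 1` are active. -/
def piece (i : ℕ) : Set ℝ := {x | stepEnd (i + 1) < x ∧ ∀ j < i, x < stepStart j}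

theorem isOpen_piece (i : ℕ) : IsOpen (piece i) := by
  have : piece i = Ioi (stepEnd (i + 1)) ∩ ⋂ j ∈ Iio i, Iio (stepStart j) := by
    ext x; simp [piece]
  rw [this]
  exact isOpen_Ioi.inter ((finite_Iio i).isOpen_biInter fun _ _ => isOpen_Iio)

theorem mem_piece {i : ℕ} {x : ℝ} (h1 : stepEnd (i + 1) < x) (h2 : x ≤ stepEnd i) :
    x ∈ piece i := by
  refine ⟨h1, fun j hj => h2.trans_lt ?_⟩
  exact (stepEnd_strictAnti.antitone (Nat.succ_le_of_lt hj)).trans_lt (stepEnd_succ_lt_stepStart j)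

theorem mem_piece_zero {x : ℝ} (h1 : stepEnd 1 < x) : x ∈ piece 0 :=
  ⟨h1, fun _ hj => absurd hj (Nat.not_lt_zero _)⟩

/-- Steps of index below `i` have not started and those above `i` are complete, so the differences
telescope to two active windows. -/
theorem window_eq_of_mem_piece {i : ℕ} {x : ℝ} (hx : x ∈ piece i) (j : ℕ) :
    window j x = if j = i then step i x else if j = i + 1 then 1 - step i x else 0 := by
  have h0 : ∀ j < i, step j x = 0 := fun j hj => step_eq_zero (hx.2 j hj).le
  have h1 : ∀ j, i < j → step j x = 1 := fun j hj =>
    step_eq_one ((stepEnd_strictAnti.antitone (Nat.succ_le_of_lt hj)).trans hx.1.le)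
  rcases j with _ | j
  · rcases Nat.eq_zero_or_pos i with rfl | hi
    · simp [window]
    · simp [window, h0 0 hi, hi.ne]
  · rcases lt_trichotomy j i with h | rfl | h
    · rcases (Nat.succ_le_of_lt h).lt_or_eq with h' | h'
      · rw [if_neg (by omega), if_neg (by omega)]
        simp [window, h0 _ h, h0 _ h']
      · rw [if_pos h']
        simp [window, h0 _ h, ← h']
    · simp [window, h1 (j + 1) (Nat.lt_succ_self j)]
    · rw [if_neg (by omega), if_neg (by omega)]
      simp [window, h1 _ h, h1 (j + 1) (by omega)]

theorem hasSum_window {i : ℕ} {x : ℝ} (hx : x ∈ piece i) (c : ℕ → ℝ) :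
    HasSum (fun j => c j * window j x) (c i * step i x + c (i + 1) * (1 - step i x)) := by
  have h : ∀ j, j ∉ ({i, i + 1} : Finset ℕ) → c j * window j x = 0 := fun j hj => by
    simp only [Finset.mem_insert, Finset.mem_singleton, not_or] at hj
    rw [window_eq_of_mem_piece hx, if_neg hj.1, if_neg hj.2, mul_zero]
  have h2 : HasSum (fun j => c j * window j x)
      (∑ j ∈ ({i, i + 1} : Finset ℕ), c j * window j x) := hasSum_sum_of_ne_finset_zero h
  rw [Finset.sum_pair (by omega)] at h2
  simpa [window_eq_of_mem_piece hx] using h2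

theorem exists_mem_piece {x : ℝ} (hx : 0 < x) : ∃ i, x ∈ piece i := by
  rcases le_or_gt x (3 / 8) with h | h
  · obtain ⟨i, h1, h2⟩ := exists_mem_Ioc_stepEnd hx h
    exact ⟨i, mem_piece h1 h2⟩
  · exact ⟨0, mem_piece_zero (by rw [stepEnd_one]; linarith)⟩

theorem summable_mul_window (c : ℕ → ℝ) (x : ℝ) : Summable fun j => c j * window j x := by
  rcases le_or_gt x 0 with h | h
  · simp [window_eq_zero_of_nonpos h, summable_zero]
  · obtain ⟨i, hi⟩ := exists_mem_piece h
    exact (hasSum_window hi c).summable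

end UnimodalProfile

/-! ### Construction of the profile. -/

open UnimodalProfile in
/-- `φ` is a smooth function on `ℝ`, vanishing on `(-∞, 0]`, increasing on `[0, ∞)` and equal to
`2x` beyond `3/8`, such that on the `i`-th core (`i ≥ 1`), the interval with centre
`coreCenter i` and radius `coreRadius i`, the function `2^i φ` is affine up to an oscillating
polynomial, and such that off the cores `2^j φ` has slope larger than one where its value lies in `(5/8, 5/4]`. -/
structure IsProfile (N : ℕ → ℕ) (δ : ℕ → ℝ) (φ : ℝ → ℝ) : Prop where
  contDiff : ContDiff ℝ ∞ φ
  eq_zero_of_nonpos : ∀ x ≤ 0, φ x = 0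
  eq_two_mul : ∀ x, 3 / 8 ≤ x → φ x = 2 * x
  deriv_pos : ∀ x, 0 < x → 0 < deriv φ x
  pos : ∀ i ≠ 0, 0 < δ i
  eq_on_core : ∀ i ≠ 0, ∀ x ∈ Metric.closedBall (coreCenter i) (coreRadius i), 2 ^ i * φ x =
    plateauSlope i *
      (x + plateauOffset i + δ i * oscPoly (coreRadius i / N i) (N i) (x - coreCenter i))
  deriv_on_core : ∀ i ≠ 0, ∀ x ∈ Metric.closedBall (coreCenter i) (coreRadius i),
    2 ^ i * deriv φ x =
    plateauSlope i * (1 + δ i * oscPolyDeriv (coreRadius i / N i) (N i) (x - coreCenter i))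
  deriv_core_pos : ∀ i ≠ 0, ∀ x ∈ Metric.closedBall (coreCenter i) (coreRadius i),
    0 < 1 + δ i * oscPolyDeriv (coreRadius i / N i) (N i) (x - coreCenter i)
  one_lt_deriv : ∀ x ∈ Ioo (0 : ℝ) (3 / 8),
    (∀ i ≠ 0, x ∉ Metric.closedBall (coreCenter i) (coreRadius i)) →
    ∀ j : ℕ, 5 / 8 < 2 ^ j * φ x → 2 ^ j * φ x ≤ 5 / 4 → 1 < 2 ^ j * deriv φ x

namespace UnimodalProfile

theorem coreRadius_pos (i : ℕ) : 0 < coreRadius i := by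
  rcases i with _ | _ | i
  · norm_num [coreRadius]
  · norm_num [coreRadius]
  · have := stepEnd_succ_lt_stepStart (i + 1)
    simp only [coreRadius]
    linarith

theorem plateauSlope_pos (i : ℕ) : 0 < plateauSlope i := by
  rcases i with _ | _ | i <;> norm_num [plateauSlope]

theorem core_subset (i : ℕ) {x : ℝ}
    (hx : x ∈ Metric.closedBall (coreCenter (i + 1)) (coreRadius (i + 1))) :
    stepEnd (i + 1) < x ∧ x < stepStart i := by
  rw [Real.closedBall_eq_Icc] at hx
  obtain ⟨h1, h2⟩ := hx
  rcases i with _ | i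
  · simp only [zero_add, coreCenter, coreRadius, stepEnd_one, stepStart_zero] at *
    constructor <;> linarith
  · have := stepEnd_succ_lt_stepStart (i + 1)
    simp only [coreCenter, coreRadius] at *
    constructor <;> linarith

/-- The perturbation on the `i`-th plateau, before scaling. -/
noncomputable def wiggle (N : ℕ → ℕ) (i : ℕ) (x : ℝ) : ℝ :=
  oscPoly (coreRadius i / N i) (N i) (x - coreCenter i)

/-- The derivative of `wiggle`. -/
noncomputable def wiggleDeriv (N : ℕ → ℕ) (i : ℕ) (x : ℝ) : ℝ :=
  oscPolyDeriv (coreRadius i / N i) (N i) (x - coreCenter i)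

theorem contDiff_wiggle (N : ℕ → ℕ) (i : ℕ) : ContDiff ℝ ∞ (wiggle N i) :=
  (contDiff_oscPoly _ _).comp (contDiff_id.sub contDiff_const)

theorem hasDerivAt_wiggle (N : ℕ → ℕ) (i : ℕ) (x : ℝ) :
    HasDerivAt (wiggle N i) (wiggleDeriv N i x) x := by
  have h := (hasDerivAt_oscPoly (coreRadius i / N i) (N i) (x - coreCenter i)).comp x
    ((hasDerivAt_id x).sub_const (coreCenter i))
  exact h.congr_deriv (mul_one _)

theorem wiggleDeriv_pos {N : ℕ → ℕ} {i : ℕ} (hN : 1 ≤ N i) {x : ℝ}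
    (hx : x ∉ Metric.closedBall (coreCenter i) (coreRadius i)) : 0 < wiggleDeriv N i x := by
  have hN' : (0 : ℝ) < N i := by exact_mod_cast hN
  refine oscPolyDeriv_pos (div_pos (coreRadius_pos i) hN') ?_
  rw [Metric.mem_closedBall, Real.dist_eq, not_le] at hx
  rw [mul_div_cancel₀ _ hN'.ne']
  exact hx.le

/-- The bound `1/96` keeps plateau values under control, and `1/2` keeps slopes positive on the
cores. The diagonal range `k ≤ i` suffices for smoothness: each order `k` is controlled for all but
finitely many `i`. -/
theorem exists_amplitudes (N : ℕ → ℕ) : ∃ δ : ℕ → ℝ, δ 0 = 0 ∧ (∀ i ≠ 0, 0 < δ i) ∧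
    (∀ i, ∀ x ∈ Icc (0 : ℝ) 1, |δ i * wiggle N i x| ≤ 1 / 96 ∧ |δ i * wiggleDeriv N i x| ≤ 1 / 2) ∧
    ∀ i, ∀ k ≤ i, ∀ x,
      δ i * ‖iteratedFDeriv ℝ k (fun x => wiggle N i x * window i x) x‖ ≤ 1 := by
  have h := fun i => exists_small_factor (contDiff_wiggle N (i + 1)).continuous
    ((continuous_oscPolyDeriv (coreRadius (i + 1) / N (i + 1)) (N (i + 1))).comp
      (continuous_id.sub (continuous_const (y := coreCenter (i + 1)))))
    ((contDiff_wiggle N (i + 1)).mul (contDiff_window (i + 1)))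
    ((hasCompactSupport_window i).mul_left (f := wiggle N (i + 1))) (i + 1)
  choose δ h1 h2 h3 using h
  refine ⟨fun i => Nat.casesOn i 0 δ, rfl, ?_, ?_, ?_⟩
  · rintro (_ | i) hi
    · exact absurd rfl hi
    · exact h1 i
  · rintro (_ | i) x hx
    · norm_num
    · exact h2 i x hx
  · rintro (_ | i) k hk x
    · simp
    · exact h3 i k hk x

section

variable (N : ℕ → ℕ) (δ : ℕ → ℝ)

/-- The perturbed affine function on the `i`-th plateau. -/
noncomputable def plateau (i : ℕ) (x : ℝ) : ℝ :=
  plateauSlope i * (x + plateauOffset i + δ i * wiggle N i x)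

/-- The derivative of `plateau`. -/
noncomputable def plateauDeriv (i : ℕ) (x : ℝ) : ℝ :=
  plateauSlope i * (1 + δ i * wiggleDeriv N i x)

/-- The profile glued from the plateaus. -/
noncomputable def profile (x : ℝ) : ℝ := ∑' i, (1 / 2 : ℝ) ^ i * plateau N δ i x * window i x

variable {N δ}

theorem hasDerivAt_plateau (i : ℕ) (x : ℝ) :
    HasDerivAt (plateau N δ i) (plateauDeriv N δ i x) x :=
  (((hasDerivAt_id x).add_const (plateauOffset i)).add
    ((hasDerivAt_wiggle N i x).const_mul (δ i))).const_mul (plateauSlope i)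

theorem profile_of_nonpos {x : ℝ} (hx : x ≤ 0) : profile N δ x = 0 := by
  simp [profile, window_eq_zero_of_nonpos hx]

theorem profile_of_mem_piece {i : ℕ} {x : ℝ} (hx : x ∈ piece i) :
    2 ^ (i + 1) * profile N δ x =
      (1 - step i x) * plateau N δ (i + 1) x + 2 * step i x * plateau N δ i x := by
  rw [profile, (hasSum_window hx fun i => (1 / 2 : ℝ) ^ i * plateau N δ i x).tsum_eq]
  have h : (2 : ℝ) ^ i * (1 / 2) ^ i = 1 := by rw [← mul_pow]; norm_num
  rw [pow_succ, pow_succ]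
  linear_combination (2 * plateau N δ i x * step i x +
    plateau N δ (i + 1) x * (1 - step i x)) * h

theorem hasDerivAt_profile {i : ℕ} {x : ℝ} (hx : x ∈ piece i) :
    HasDerivAt (fun x => 2 ^ (i + 1) * profile N δ x)
      ((1 - step i x) * plateauDeriv N δ (i + 1) x + 2 * step i x * plateauDeriv N δ i x +
        stepDeriv i x * (2 * plateau N δ i x - plateau N δ (i + 1) x)) x := by
  have h1 := (((hasDerivAt_step i x).const_sub 1).mul
    (hasDerivAt_plateau (N := N) (δ := δ) (i + 1) x)).add
    (((hasDerivAt_step i x).const_mul 2).mul (hasDerivAt_plateau (N := N) (δ := δ) i x))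
  refine (h1.congr_of_eventuallyEq ?_).congr_deriv (by ring)
  filter_upwards [(isOpen_piece i).mem_nhds hx] with y hy
  exact profile_of_mem_piece hy

theorem contDiff_tsum_wiggle
    (hδ : ∀ i ≠ 0, 0 < δ i) (h0 : δ 0 = 0) (hsmall : ∀ i, ∀ k ≤ i, ∀ x,
      δ i * ‖iteratedFDeriv ℝ k (fun x => wiggle N i x * window i x) x‖ ≤ 1) :
    ContDiff ℝ ∞ fun x =>
      ∑' i, ((1 / 2 : ℝ) ^ i * plateauSlope i * δ i) * (wiggle N i x * window i x) := by
  have hcd : ∀ i, ContDiff ℝ ∞ fun x => wiggle N i x * window i x := fun i =>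
    (contDiff_wiggle N i).mul (contDiff_window i)
  refine contDiff_tsum_of_eventually (v := fun (_ i : ℕ) => (1 / 2 : ℝ) ^ i * 2)
    (fun i => contDiff_const.mul (hcd i))
    (fun k _ => (summable_geometric_of_lt_one (by norm_num) (by norm_num)).mul_right 2)
    fun k _ => ?_
  rw [Nat.cofinite_eq_atTop]
  filter_upwards [Filter.eventually_ge_atTop k] with i hi x
  have h : iteratedFDeriv ℝ k
      (fun x => ((1 / 2 : ℝ) ^ i * plateauSlope i * δ i) * (wiggle N i x * window i x)) x =
      ((1 / 2 : ℝ) ^ i * plateauSlope i * δ i) •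
        iteratedFDeriv ℝ k (fun x => wiggle N i x * window i x) x :=
    iteratedFDeriv_const_smul_apply (a := (1 / 2 : ℝ) ^ i * plateauSlope i * δ i)
      ((hcd i).of_le (mod_cast le_top)).contDiffAt
  have hd : 0 ≤ δ i := by
    rcases eq_or_ne i 0 with rfl | h
    · exact h0.ge
    · exact (hδ i h).le
  have hs := plateauSlope_pos i
  have hs2 : plateauSlope i ≤ 2 := by rcases i with _ | _ | i <;> norm_num [plateauSlope]
  rw [h, norm_smul, Real.norm_of_nonneg (by positivity), mul_assoc, mul_assoc]
  have := hsmall i k hi x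
  gcongr
  nlinarith [norm_nonneg (iteratedFDeriv ℝ k (fun x => wiggle N i x * window i x) x)]

/-- Every unperturbed plateau with `i ≥ 2` is the same function `1 + x`. Factoring it out leaves a
series of windows, two correction terms and the series of wiggles, each visibly smooth. -/
theorem profile_eq (x : ℝ) : profile N δ x =
    (1 + x) * (∑' i, (1 / 2 : ℝ) ^ i * window i x) +
      ((x - 1) * window 0 x + 1 / 2 * (x - 1 / 3) * window 1 x) +
      ∑' i, ((1 / 2 : ℝ) ^ i * plateauSlope i * δ i) * (wiggle N i x * window i x) := by
  set r : ℕ → ℝ := fun i => (1 / 2) ^ i * (plateauSlope i * (x + plateauOffset i) - (1 + x)) with hr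
  have h1 : ∑' i, r i * window i x = (x - 1) * window 0 x + 1 / 2 * (x - 1 / 3) * window 1 x := by
    rw [tsum_eq_sum (s := {0, 1}), Finset.sum_pair (by norm_num)]
    · simp only [hr, plateauSlope, plateauOffset]
      ring
    · rintro (_ | _ | i) hi
      · simp at hi
      · simp at hi
      · simp only [hr, plateauSlope, plateauOffset]
        ring
  rw [← h1, ← tsum_mul_left, ← Summable.tsum_add ((summable_mul_window _ x).mul_left _)
    (summable_mul_window r x), ← Summable.tsum_add]
  · refine tsum_congr fun i => ?_
    simp only [hr, plateau]
    ring
  · exact ((summable_mul_window _ x).mul_left _).add (summable_mul_window r x)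
  · refine (summable_mul_window
      (fun i => (1 / 2 : ℝ) ^ i * plateauSlope i * δ i * wiggle N i x) x).congr
      fun i => ?_
    ring

theorem contDiff_profile
    (hδ : ∀ i ≠ 0, 0 < δ i) (h0 : δ 0 = 0) (hsmall : ∀ i, ∀ k ≤ i, ∀ x,
      δ i * ‖iteratedFDeriv ℝ k (fun x => wiggle N i x * window i x) x‖ ≤ 1) :
    ContDiff ℝ ∞ (profile N δ) := by
  rw [funext (profile_eq (N := N) (δ := δ))]
  have h2 := contDiff_window 0
  have h3 := contDiff_window 1
  exact (((contDiff_const.add contDiff_id).mul contDiff_tsum_window).add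
    (((contDiff_id.sub contDiff_const).mul h2).add
      ((contDiff_const.mul (contDiff_id.sub contDiff_const)).mul h3))).add
    (contDiff_tsum_wiggle hδ h0 hsmall)

end

theorem exists_isProfile {N : ℕ → ℕ} (hN : ∀ i, 1 ≤ N i) :
    ∃ (δ : ℕ → ℝ) (φ : ℝ → ℝ), IsProfile N δ φ := by
  obtain ⟨δ, hδ0, hδ, hsmall, hsmall'⟩ := exists_amplitudes N
  have hcd := contDiff_profile hδ hδ0 hsmall'
  have hD : ∀ {i : ℕ} {x : ℝ}, x ∈ piece i → 2 ^ (i + 1) * deriv (profile N δ) x =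
      (1 - step i x) * plateauDeriv N δ (i + 1) x + 2 * step i x * plateauDeriv N δ i x +
        stepDeriv i x * (2 * plateau N δ i x - plateau N δ (i + 1) x) := fun {i x} hx => by
    rw [← (hasDerivAt_profile hx).deriv, deriv_const_mul _ (hcd.differentiable (by simp) x)]
  have hcore_piece : ∀ {i : ℕ} {x : ℝ},
      x ∈ Metric.closedBall (coreCenter (i + 1)) (coreRadius (i + 1)) → x ∈ piece i := fun hx =>
    mem_piece (core_subset _ hx).1 ((core_subset _ hx).2.trans (stepStart_lt_stepEnd _)).le
  have hcore_unit : ∀ {i : ℕ} {x : ℝ},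
      x ∈ Metric.closedBall (coreCenter (i + 1)) (coreRadius (i + 1)) → x ∈ Icc (0 : ℝ) 1 := by
    intro i x hx
    have h1 := core_subset _ hx
    have h2 := stepStart_strictAnti.antitone (Nat.zero_le i)
    rw [stepStart_zero] at h2
    exact ⟨((stepEnd_pos _).trans h1.1).le, by linarith [h1.2]⟩
  have hcore_deriv : ∀ i, ∀ x ∈ Metric.closedBall (coreCenter (i + 1)) (coreRadius (i + 1)),
      2 ^ (i + 1) * deriv (profile N δ) x = plateauDeriv N δ (i + 1) x := fun i x hx => by
    have h := (core_subset _ hx).2.le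
    rw [hD (hcore_piece hx), step_eq_zero h, stepDeriv_eq_zero_of_le h]
    ring
  have hcore_pos : ∀ i, ∀ x ∈ Metric.closedBall (coreCenter (i + 1)) (coreRadius (i + 1)),
      0 < 1 + δ (i + 1) * wiggleDeriv N (i + 1) x := fun i x hx => by
    linarith [(abs_le.1 (hsmall (i + 1) x (hcore_unit hx)).2).1]
  -- Off the cores every wiggle has positive derivative, hence the strict inequality.
  have hpd : ∀ i ≠ 0, ∀ x, (∀ j ≠ 0, x ∉ Metric.closedBall (coreCenter j) (coreRadius j)) →
      plateauSlope i < plateauDeriv N δ i x := fun i hi x hx =>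
    lt_mul_of_one_lt_right (plateauSlope_pos i)
      (lt_add_of_pos_right 1 (mul_pos (hδ i hi) (wiggleDeriv_pos (hN i) (hx i hi))))
  have hpd0 : ∀ x, plateauDeriv N δ 0 x = 2 := fun x => by simp [plateauDeriv, hδ0, plateauSlope]
  have hpd' : ∀ i, ∀ x, (∀ j ≠ 0, x ∉ Metric.closedBall (coreCenter j) (coreRadius j)) →
      1 < plateauDeriv N δ i x := fun i x hx => by
    rcases i with _ | i
    · rw [hpd0]; norm_num
    · refine lt_of_le_of_lt ?_ (hpd (i + 1) (by omega) x hx)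
      rcases i with _ | i <;> norm_num [plateauSlope]
  -- For the upper bounds the extreme case is `1/8 + 1 + 1/96 < 55/48`. The lower bound is tightest
  -- at `i = 0`, where it reads `1/3 - 5/96 > 1/4`.
  have hbounds : ∀ i, ∀ x ∈ Ioc (stepEnd (i + 2)) (stepEnd (i + 1)),
      plateau N δ (i + 1) x ≤ 55 / 48 ∧ plateau N δ (i + 2) x ≤ 55 / 48 ∧
        1 / 4 ≤ 2 * plateau N δ (i + 1) x - plateau N δ (i + 2) x := by
    intro i x hx
    have h0 : 0 < x := (stepEnd_pos _).trans hx.1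
    have h1 : x ≤ 1 / 8 := hx.2.trans (stepEnd_le_of_ne_zero (Nat.succ_ne_zero i))
    have hI : x ∈ Icc (0 : ℝ) 1 := ⟨h0.le, by linarith⟩
    have hw1 := abs_le.1 (hsmall (i + 1) x hI).1
    have hw2 := abs_le.1 (hsmall (i + 2) x hI).1
    rcases i with _ | i <;> simp only [plateau, plateauSlope, plateauOffset, zero_add] at * <;>
      refine ⟨?_, ?_, ?_⟩ <;> linarith
  have hlarge : ∀ i, ∀ x ∈ piece i, (∀ j ≠ 0, x ∉ Metric.closedBall (coreCenter j) (coreRadius j)) →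
      0 ≤ stepDeriv i x * (2 * plateau N δ i x - plateau N δ (i + 1) x) →
      1 < 2 ^ (i + 1) * deriv (profile N δ) x := by
    intro i x hx hxc hp
    rw [hD hx]
    have h1 := hpd' i x hxc
    have h2 := hpd' (i + 1) x hxc
    have h3 := step_nonneg i x
    have h4 := step_le_one i x
    rcases h3.eq_or_lt with h5 | h5
    · rw [← h5]
      linarith
    · nlinarith
  have htop : ∀ x ∈ Icc (1 / 8 : ℝ) 1,
      0 ≤ stepDeriv 0 x * (2 * plateau N δ 0 x - plateau N δ 1 x) := by
    intro x hx
    rcases le_or_gt x (stepStart 0) with h | h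
    · rw [stepDeriv_eq_zero_of_le h, zero_mul]
    -- The lines `2x` and `x + 1/3` cross at `1/3`. The transition starts at `17/48 = 1/3 + 1/48`,
    -- far enough to the right to outweigh a wiggle of size `1/96`.
    · refine mul_nonneg (stepDeriv_nonneg 0 x) ?_
      rw [stepStart_zero] at h
      have hw := abs_le.1 (hsmall 1 x ⟨by linarith [hx.1], hx.2⟩).1
      simp only [plateau, plateauSlope, plateauOffset, hδ0]
      linarith
  have hnonneg : ∀ i, ∀ x ∈ Ioc (stepEnd (i + 1)) (stepEnd i),
      0 ≤ stepDeriv i x * (2 * plateau N δ i x - plateau N δ (i + 1) x) := by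
    rintro (_ | i) x hx
    · simp only [zero_add, stepEnd_one, stepEnd_zero] at hx
      exact htop x ⟨hx.1.le, by linarith [hx.2]⟩
    · exact mul_nonneg (stepDeriv_nonneg _ _) (by linarith [(hbounds i x hx).2.2])
  have heq_two : ∀ x, 3 / 8 ≤ x → profile N δ x = 2 * x := fun x hx => by
    have h := profile_of_mem_piece (N := N) (δ := δ)
      (mem_piece_zero (x := x) (by rw [stepEnd_one]; linarith))
    rw [step_eq_one (by rw [stepEnd_zero]; exact hx)] at h
    simp only [plateau, hδ0, plateauSlope, plateauOffset] at h
    linarith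
  have hderiv_pos : ∀ x, 0 < x → 0 < deriv (profile N δ) x := by
    intro x hx
    rcases le_or_gt x (3 / 8) with h | h
    · by_cases hc : ∀ j ≠ 0, x ∉ Metric.closedBall (coreCenter j) (coreRadius j)
      · obtain ⟨i, hi1, hi2⟩ := exists_mem_Ioc_stepEnd hx h
        have := hlarge i x (mem_piece hi1 hi2) hc (hnonneg i x ⟨hi1, hi2⟩)
        exact pos_of_mul_pos_right (zero_lt_one.trans this) (by positivity)
      · push Not at hc
        obtain ⟨_ | i, hi, hx⟩ := hc
        · exact absurd rfl hi
        · have := mul_pos (plateauSlope_pos (i + 1)) (hcore_pos i x hx)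
          rw [← plateauDeriv, ← hcore_deriv i x hx] at this
          exact pos_of_mul_pos_right this (by positivity)
    · have h2 : profile N δ =ᶠ[nhds x] fun x => 2 * x := by
        filter_upwards [Ioi_mem_nhds h] with y hy using heq_two y (le_of_lt hy)
      rw [h2.deriv_eq]
      simp
  refine ⟨δ, profile N δ, hcd, fun x hx => profile_of_nonpos hx, heq_two, hderiv_pos, hδ,
    ?_, ?_, ?_, ?_⟩
  · rintro (_ | i) hi x hx
    · exact absurd rfl hi
    · rw [profile_of_mem_piece (hcore_piece hx), step_eq_zero (core_subset _ hx).2.le]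
      simp [plateau, wiggle]
  · rintro (_ | i) hi x hx
    · exact absurd rfl hi
    · exact hcore_deriv i x hx
  · rintro (_ | i) hi x hx
    · exact absurd rfl hi
    · exact hcore_pos i x hx
  · intro x hx hxc j hj _
    have hφ : 0 < profile N δ x :=
      pos_of_mul_pos_right ((by norm_num : (0 : ℝ) < 5 / 8).trans hj) (by positivity)
    have hφ' := hderiv_pos x hx.1
    obtain ⟨i, hi1, hi2⟩ := exists_mem_Ioc_stepEnd hx.1 hx.2.le
    have hmem := mem_piece hi1 hi2
    have hn := hnonneg i x ⟨hi1, hi2⟩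
    have hS0 := step_nonneg i x
    have hS1 := step_le_one i x
    have hd := hD hmem
    rcases i with _ | i
    · have h1 := hpd 1 one_ne_zero x hxc
      simp only [plateauSlope] at h1
      rw [hpd0] at hd
      have h2 : 1 < deriv (profile N δ) x := by
        rcases hS0.eq_or_lt with h5 | h5
        · rw [← h5] at hd
          simp only [zero_add, pow_one] at hd hn
          linarith
        · simp only [zero_add, pow_one] at hd hn
          nlinarith
      exact h2.trans_le (le_mul_of_one_le_left hφ'.le (one_le_pow₀ (by norm_num)))
    · obtain ⟨hb1, hb2, hb3⟩ := hbounds i x ⟨hi1, hi2⟩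
      have hv := profile_of_mem_piece (N := N) (δ := δ) hmem
      -- With `S = step (i + 1) x`, `hbounds` gives `2^(i+2) φ ≤ (1 + S) 55/48`. A level `j ≤ i`
      -- would then give `2^j φ ≤ 55/96 < 5/8`. For `j ≥ i + 2` the bound `hlarge` is enough. The
      -- critical level is `j = i + 1`, where `2^(i+2) φ' > 2` is needed.
      rcases lt_trichotomy j (i + 1) with h | rfl | h
      · exfalso
        have h1 : (2 : ℝ) ^ j * profile N δ x ≤ 2 ^ i * profile N δ x := by
          gcongr
          · norm_num
          · omega
        have h2 : (2 : ℝ) ^ (i + 1 + 1) = 4 * 2 ^ i := by ring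
        rw [h2] at hv
        nlinarith
      · have h1 := hpd' (i + 1) x hxc
        have h2 := hpd' (i + 2) x hxc
        rw [pow_succ] at hv hd
        -- Here `5/4 < (1 + S) 55/48`, so `1 + S > 12/11`. The transition term is then at least `64
        -- S (1 - S) / 4 ≥ 1 - S`, and the total slope exceeds `(1 - S) + 2S + (1 - S) = 2`.
        have h3 : 1 / 11 < step (i + 1) x := by nlinarith
        have h4 := le_stepDeriv (i + 1) x
        have h5 := stepDeriv_nonneg (i + 1) x
        have h6 : 16 * step (i + 1) x * (1 - step (i + 1) x) ≤ stepDeriv (i + 1) x *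
            (2 * plateau N δ (i + 1) x - plateau N δ (i + 2) x) := by nlinarith
        have h7 : 1 - step (i + 1) x ≤ 16 * step (i + 1) x * (1 - step (i + 1) x) := by nlinarith
        have h8 : 1 - step (i + 1) x ≤ (1 - step (i + 1) x) * plateauDeriv N δ (i + 2) x :=
          le_mul_of_one_le_right (by linarith) h2.le
        have h9 : 2 * step (i + 1) x < 2 * step (i + 1) x * plateauDeriv N δ (i + 1) x :=
          lt_mul_of_one_lt_right (by linarith) h1
        have h10 : i + 1 + 1 = i + 2 := rfl
        rw [h10] at hd
        linarith
      · refine (hlarge (i + 1) x hmem hxc hn).trans_le ?_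
        gcongr
        · norm_num
        · omega

end UnimodalProfile

/-! ### Multipliers along orbits, and periodic points of increasing maps. -/

/-- The absolute value of the derivative of the `n`-th iterate, as a product along the orbit. -/
noncomputable def absMultiplier (f : ℝ → ℝ) (n : ℕ) (x : ℝ) : ℝ :=
  ∏ j ∈ Finset.range n, |deriv f (f^[j] x)|

theorem absMultiplier_add (f : ℝ → ℝ) (m n : ℕ) (x : ℝ) :
    absMultiplier f (m + n) x = absMultiplier f m x * absMultiplier f n (f^[m] x) := by
  simp only [absMultiplier, Finset.prod_range_add, ← iterate_add_apply]
  congr 1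
  exact Finset.prod_congr rfl fun j _ => by rw [add_comm]

theorem absMultiplier_succ (f : ℝ → ℝ) (n : ℕ) (x : ℝ) :
    absMultiplier f (n + 1) x = absMultiplier f n x * |deriv f (f^[n] x)| :=
  Finset.prod_range_succ _ _

theorem absMultiplier_one (f : ℝ → ℝ) (x : ℝ) : absMultiplier f 1 x = |deriv f x| := by
  simp [absMultiplier]

theorem abs_deriv_iterate {f : ℝ → ℝ} (hf : Differentiable ℝ f) (n : ℕ) (x : ℝ) :
    |deriv f^[n] x| = absMultiplier f n x := by
  induction n with
  | zero => simp [absMultiplier]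
  | succ n ih =>
    rw [iterate_succ', deriv_comp _ (hf _) (hf.iterate n x), abs_mul, ih, absMultiplier_succ,
      mul_comm]

theorem absMultiplier_apply {f : ℝ → ℝ} {n : ℕ} {x : ℝ} (hx : f^[n] x = x) :
    absMultiplier f n (f x) = absMultiplier f n x := by
  rcases n with _ | n
  · rfl
  · have h1 := absMultiplier_add f 1 n x
    have h2 := absMultiplier_succ f n (f x)
    rw [← iterate_succ_apply, hx] at h2
    rw [h2, add_comm n 1, h1, absMultiplier_one, mul_comm]
    rfl

theorem absMultiplier_iterate {f : ℝ → ℝ} {n : ℕ} {x : ℝ} (hx : f^[n] x = x) (k : ℕ) :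
    absMultiplier f n (f^[k] x) = absMultiplier f n x := by
  induction k with
  | zero => rfl
  | succ k ih =>
    have h : f^[n] (f^[k] x) = f^[k] x := by
      rw [← iterate_add_apply, add_comm, iterate_add_apply, hx]
    rw [iterate_succ_apply', absMultiplier_apply h, ih]

theorem absMultiplier_eq_pow {f : ℝ → ℝ} {x m : ℝ} (h : ∀ k, |deriv f (f^[k] x)| = m) (n : ℕ) :
    absMultiplier f n x = m ^ n := by
  simp [absMultiplier, h]

/-- An orbit of an increasing map that moves at its first step stays strictly on that side of its
starting point. -/
theorem StrictMonoOn.eq_of_iterate_eq {g : ℝ → ℝ} {s : Set ℝ} (hg : StrictMonoOn g s)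
    (hs : MapsTo g s s) {x : ℝ} (hx : x ∈ s) {n : ℕ} (hn : n ≠ 0) (h : g^[n] x = x) : g x = x := by
  obtain ⟨n, rfl⟩ := Nat.exists_eq_succ_of_ne_zero hn
  rcases lt_trichotomy x (g x) with h1 | h1 | h1
  · have : ∀ k, x < g^[k + 1] x := fun k => by
      induction k with
      | zero => exact h1
      | succ k ih =>
        rw [iterate_succ_apply']
        exact h1.trans (hg hx (hs.iterate _ hx) ih)
    exact absurd h (this n).ne'
  · exact h1.symm
  · have : ∀ k, g^[k + 1] x < x := fun k => by
      induction k with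
      | zero => exact h1
      | succ k ih =>
        rw [iterate_succ_apply']
        exact (hg (hs.iterate _ hx) hx ih).trans h1
    exact absurd h (this n).ne

/-! ### The unimodal map and its first returns near the critical point. -/

/-- The even map `1 - φ(|x|)`. -/
def evenMap (φ : ℝ → ℝ) (x : ℝ) : ℝ := 1 - φ x - φ (-x)

theorem evenMap_neg (φ : ℝ → ℝ) (x : ℝ) : evenMap φ (-x) = evenMap φ x := by
  simp only [evenMap, neg_neg]; ring

theorem evenMap_abs (φ : ℝ → ℝ) (x : ℝ) : evenMap φ |x| = evenMap φ x := by
  rcases abs_choice x with h | h <;> rw [h]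
  exact evenMap_neg φ x

theorem evenMap_iterate_succ_abs (φ : ℝ → ℝ) (x : ℝ) (n : ℕ) :
    (evenMap φ)^[n + 1] |x| = (evenMap φ)^[n + 1] x := by
  rw [iterate_succ_apply, iterate_succ_apply, evenMap_abs]

namespace IsProfile

open UnimodalProfile

variable {N : ℕ → ℕ} {δ : ℕ → ℝ} {φ : ℝ → ℝ}

theorem differentiable (h : IsProfile N δ φ) : Differentiable ℝ φ :=
  h.contDiff.differentiable (by simp)

theorem strictMonoOn (h : IsProfile N δ φ) : StrictMonoOn φ (Ici 0) :=
  strictMonoOn_of_deriv_pos (convex_Ici 0) h.contDiff.continuous.continuousOn fun x hx => by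
    rw [interior_Ici] at hx
    exact h.deriv_pos x hx

theorem pos_of_pos (h : IsProfile N δ φ) {x : ℝ} (hx : 0 < x) : 0 < φ x := by
  have := h.strictMonoOn self_mem_Ici hx.le hx
  rwa [h.eq_zero_of_nonpos 0 le_rfl] at this

theorem deriv_of_nonpos (h : IsProfile N δ φ) {x : ℝ} (hx : x ≤ 0) : deriv φ x = 0 := by
  refine IsLocalMin.deriv_eq_zero (Filter.Eventually.of_forall fun y => ?_)
  rw [h.eq_zero_of_nonpos x hx]
  rcases le_or_gt y 0 with hy | hy
  · exact (h.eq_zero_of_nonpos y hy).ge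
  · exact (h.pos_of_pos hy).le

theorem deriv_of_ge (h : IsProfile N δ φ) {x : ℝ} (hx : 3 / 8 ≤ x) : deriv φ x = 2 := by
  have h1 := ((h.differentiable x).hasDerivAt.hasDerivWithinAt (s := Ici x))
  have h2 : HasDerivWithinAt φ 2 (Ici x) x := by
    have h3 : HasDerivWithinAt (fun y : ℝ => 2 * y) 2 (Ici x) x := by
      simpa using ((hasDerivAt_id x).const_mul 2).hasDerivWithinAt
    exact h3.congr (fun y hy => h.eq_two_mul y (hx.trans hy)) (h.eq_two_mul x hx)
  exact (uniqueDiffOn_Ici x x self_mem_Ici).eq_deriv _ h1 h2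

theorem evenMap_eq (h : IsProfile N δ φ) (x : ℝ) : evenMap φ x = 1 - φ |x| := by
  rw [← evenMap_abs, evenMap, h.eq_zero_of_nonpos (-|x|) (by simp), sub_zero]

theorem evenMap_of_ge (h : IsProfile N δ φ) {x : ℝ} (hx : 3 / 8 ≤ |x|) :
    evenMap φ x = 1 - 2 * |x| := by
  rw [h.evenMap_eq, h.eq_two_mul _ hx]

theorem contDiff_evenMap (h : IsProfile N δ φ) : ContDiff ℝ ∞ (evenMap φ) :=
  (contDiff_const.sub h.contDiff).sub (h.contDiff.comp contDiff_neg)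

theorem differentiable_evenMap (h : IsProfile N δ φ) : Differentiable ℝ (evenMap φ) :=
  h.contDiff_evenMap.differentiable (by simp)

theorem abs_deriv_evenMap (h : IsProfile N δ φ) (x : ℝ) :
    |deriv (evenMap φ) x| = deriv φ |x| := by
  have h1 : HasDerivAt (evenMap φ) (-deriv φ x + deriv φ (-x)) x := by
    have h2 := (h.differentiable (-x)).hasDerivAt.comp x (hasDerivAt_neg x)
    refine (((h.differentiable x).hasDerivAt.const_sub 1).sub h2).congr_deriv ?_
    ring
  rw [h1.deriv]
  rcases le_total 0 x with hx | hx
  · rw [h.deriv_of_nonpos (neg_nonpos.2 hx), add_zero, abs_neg, abs_of_nonneg hx]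
    rcases hx.eq_or_lt with rfl | hx
    · rw [h.deriv_of_nonpos le_rfl, abs_zero]
    · exact abs_of_pos (h.deriv_pos x hx)
  · rw [h.deriv_of_nonpos hx, neg_zero, zero_add, abs_of_nonpos hx]
    rcases hx.eq_or_lt with rfl | hx
    · rw [neg_zero, h.deriv_of_nonpos le_rfl, abs_zero]
    · exact abs_of_pos (h.deriv_pos _ (neg_pos.2 hx))

theorem map_one (h : IsProfile N δ φ) : φ 1 = 2 := by
  rw [h.eq_two_mul 1 (by norm_num)]; norm_num

theorem isSmoothUnimodal (h : IsProfile N δ φ) : IsSmoothUnimodal (evenMap φ) where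
  contDiffOn := h.contDiff_evenMap.contDiffOn
  mapsTo x hx := by
    have h1 : |x| ≤ 1 := abs_le.2 hx
    have h2 := h.strictMonoOn.monotoneOn self_mem_Ici (abs_nonneg x) (abs_nonneg x)
    have h3 := h.strictMonoOn.monotoneOn (abs_nonneg x) (zero_le_one' ℝ) h1
    rw [h.eq_zero_of_nonpos 0 le_rfl] at h2
    rw [h.map_one] at h3
    rw [h.evenMap_eq]
    constructor <;> linarith
  map_neg_one := by rw [h.evenMap_eq, abs_neg, abs_one, h.map_one]; norm_num
  map_one := by rw [h.evenMap_eq, abs_one, h.map_one]; norm_num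
  exists_critical := by
    refine ⟨0, by norm_num, fun x hx y hy hxy => ?_, fun x hx y hy hxy => ?_, fun x hx => ?_⟩
    · rw [h.evenMap_eq, h.evenMap_eq, abs_of_nonpos hx.2, abs_of_nonpos hy.2]
      have := h.strictMonoOn (neg_nonneg.2 hy.2) (neg_nonneg.2 hx.2) (neg_lt_neg hxy)
      linarith
    · rw [h.evenMap_eq, h.evenMap_eq, abs_of_nonneg hx.1, abs_of_nonneg hy.1]
      have := h.strictMonoOn hx.1 hy.1 hxy
      linarith
    · rw [(h.differentiable_evenMap x).derivWithin (uniqueDiffOn_Icc (by norm_num) x hx),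
        ← abs_eq_zero, h.abs_deriv_evenMap]
      constructor
      · intro h0
        by_contra hx0
        exact (h.deriv_pos _ (abs_pos.2 hx0)).ne' h0
      · rintro rfl
        rw [abs_zero, h.deriv_of_nonpos le_rfl]

/-- The orbit of a point near the critical point up to its first return. -/
theorem orbit_until_return (h : IsProfile N δ φ) {x : ℝ} {j : ℕ}
    (hj : 2 ^ j * φ |x| ≤ 5 / 4) (k : ℕ) (hk : k ≤ j) :
    |(evenMap φ)^[k + 1] x| = |1 - 2 ^ k * φ (|x|)| ∧
      (k ≠ 0 → (evenMap φ)^[k + 1] x = 2 ^ k * φ |x| - 1) ∧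
      (k < j → 3 / 8 ≤ |(evenMap φ)^[k + 1] x|) ∧
      absMultiplier (evenMap φ) (k + 1) x = 2 ^ k * deriv φ |x| := by
  have hy : 0 ≤ φ |x| := by
    rw [← h.eq_zero_of_nonpos 0 le_rfl]
    exact h.strictMonoOn.monotoneOn self_mem_Ici (abs_nonneg x) (abs_nonneg x)
  -- Half of `5/4`. It gives `1 - 2^k φ(|x|) ≥ 3/8`, so before time `j + 1` the orbit stays where
  -- the map is the tent `1 - 2|y|`.
  have hsmall : ∀ k < j, 2 ^ k * φ |x| ≤ 5 / 8 := fun k hk => by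
    have : (2 : ℝ) ^ (k + 1) * φ |x| ≤ 2 ^ j * φ |x| := by
      gcongr
      · norm_num
      · omega
    rw [pow_succ] at this
    linarith
  have hfar : ∀ k < j, 3 / 8 ≤ |1 - 2 ^ k * φ (|x|)| := fun k hk =>
    (by linarith [hsmall k hk] : (3 : ℝ) / 8 ≤ 1 - 2 ^ k * φ |x|).trans (le_abs_self _)
  induction k with
  | zero =>
    have h1 : (evenMap φ)^[0 + 1] x = 1 - 2 ^ 0 * φ |x| := by
      simp [h.evenMap_eq]
    refine ⟨by rw [h1], fun h0 => absurd rfl h0, fun h0 => by rw [h1]; exact hfar 0 h0, ?_⟩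
    rw [zero_add, absMultiplier_one, h.abs_deriv_evenMap, pow_zero, one_mul]
  | succ k ih =>
    obtain ⟨h1, -, h3, h4⟩ := ih (by omega)
    have h3 := h3 hk
    have h5 : (evenMap φ)^[k + 1 + 1] x = 2 ^ (k + 1) * φ |x| - 1 := by
      rw [iterate_succ_apply', h.evenMap_of_ge h3, h1,
        abs_of_nonneg (by linarith [hsmall k hk])]
      ring
    have h6 : |(evenMap φ)^[k + 1 + 1] x| = |1 - 2 ^ (k + 1) * φ (|x|)| := by
      rw [h5, abs_sub_comm]
    refine ⟨h6, fun _ => h5, fun h0 => h6 ▸ hfar _ h0, ?_⟩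
    rw [absMultiplier_succ, h4, h.abs_deriv_evenMap, h.deriv_of_ge h3]
    ring

/-- The least `j` passing `5/8` works, since each step doubles the value; for `j = 0` the upper
bound comes from `φ(3/8) = 3/4`. -/
theorem exists_level (h : IsProfile N δ φ) {x : ℝ} (hx0 : 0 < x) (hx : x < 3 / 8) :
    ∃ j : ℕ, 5 / 8 < 2 ^ j * φ x ∧ 2 ^ j * φ x ≤ 5 / 4 := by
  classical
  have hpos := h.pos_of_pos hx0
  have hex : ∃ j : ℕ, 5 / 8 < 2 ^ j * φ x := by
    obtain ⟨j, hj⟩ := pow_unbounded_of_one_lt (5 / 8 / φ x) (one_lt_two (α := ℝ))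
    exact ⟨j, (div_lt_iff₀ hpos).1 hj⟩
  refine ⟨Nat.find hex, Nat.find_spec hex, ?_⟩
  rcases hk : Nat.find hex with _ | j
  · have := h.strictMonoOn hx0.le (by norm_num : (0 : ℝ) ≤ 3 / 8) hx
    rw [h.eq_two_mul _ le_rfl] at this
    linarith
  · have := Nat.find_min hex (m := j) (by omega)
    rw [pow_succ]
    linarith

/-- Strong induction cuts the orbit segment at its first return, whose factor `2^j φ'(|x|)` exceeds
`1` by `one_lt_deriv`. -/
theorem one_lt_absMultiplier (h : IsProfile N δ φ) (n : ℕ) : ∀ x : ℝ, n ≠ 0 → |x| < 3 / 8 →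
    |(evenMap φ)^[n] x| < 3 / 8 → (∀ k, (evenMap φ)^[k] x ≠ 0) →
    (∀ k, ∀ i ≠ 0, |(evenMap φ)^[k] x| ∉ Metric.closedBall (coreCenter i) (coreRadius i)) →
    1 < absMultiplier (evenMap φ) n x := by
  induction n using Nat.strong_induction_on with
  | _ n ih =>
    intro x hn hx hret h0 hc
    have hpos : 0 < |x| := abs_pos.2 (h0 0)
    obtain ⟨j, hj1, hj2⟩ := h.exists_level hpos hx
    have hw := h.one_lt_deriv |x| ⟨hpos, hx⟩ (hc 0) j hj1 hj2
    obtain ⟨h1, -, -, h4⟩ := h.orbit_until_return hj2 j le_rfl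
    have hnj : j + 1 ≤ n := by
      by_contra hlt
      obtain ⟨k, rfl⟩ := Nat.exists_eq_succ_of_ne_zero hn
      have := (h.orbit_until_return hj2 k (by omega)).2.2.1 (by omega)
      exact absurd hret (not_lt.2 this)
    obtain ⟨m, rfl⟩ := Nat.exists_eq_add_of_le hnj
    rw [absMultiplier_add, h4]
    rcases eq_or_ne m 0 with rfl | hm
    · simpa [absMultiplier] using hw
    -- The level window `(5/8, 5/4]` is exactly what puts `2^j φ - 1` in `(-3/8, 1/4]`.
    · have hA : |(evenMap φ)^[j + 1] x| < 3 / 8 := by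
        rw [h1, abs_lt]
        constructor <;> linarith
      refine one_lt_mul_of_lt_of_le hw (ih m (by omega) _ hm hA ?_ ?_ ?_).le
      · rwa [← iterate_add_apply, add_comm]
      · intro k
        rw [← iterate_add_apply]
        exact h0 _
      · intro k
        rw [← iterate_add_apply]
        exact hc _

end IsProfile

/-! ### Return maps of the cores. -/

namespace IsProfile

open UnimodalProfile

variable {N : ℕ → ℕ} {δ : ℕ → ℝ} {φ : ℝ → ℝ}

/-- The increasing model for the return map of the `i`-th core. -/
noncomputable def coreMap (N : ℕ → ℕ) (δ : ℕ → ℝ) (i : ℕ) (x : ℝ) : ℝ :=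
  x + δ i * oscPoly (coreRadius i / N i) (N i) (x - coreCenter i)

theorem coreMap_strictMonoOn (h : IsProfile N δ φ) {i : ℕ} (hi : i ≠ 0) :
    StrictMonoOn (coreMap N δ i) (Metric.closedBall (coreCenter i) (coreRadius i)) := by
  have hd : ∀ x, HasDerivAt (coreMap N δ i)
      (1 + δ i * oscPolyDeriv (coreRadius i / N i) (N i) (x - coreCenter i)) x := fun x => by
    have h1 := (hasDerivAt_oscPoly (coreRadius i / N i) (N i) (x - coreCenter i)).comp x
      ((hasDerivAt_id x).sub_const (coreCenter i))
    rw [mul_one] at h1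
    exact (hasDerivAt_id x).add (h1.const_mul (δ i))
  refine strictMonoOn_of_deriv_pos (convex_closedBall _ _)
    (fun x _ => (hd x).continuousAt.continuousWithinAt) fun x hx => ?_
  rw [(hd x).deriv]
  exact h.deriv_core_pos i hi x (interior_subset hx)

/-- The endpoints of the core are roots of the polynomial, hence fixed, and the map is increasing.
-/
theorem coreMap_mapsTo (h : IsProfile N δ φ) {i : ℕ} (hi : i ≠ 0) (hN : 1 ≤ N i) :
    MapsTo (coreMap N δ i) (Metric.closedBall (coreCenter i) (coreRadius i))
      (Metric.closedBall (coreCenter i) (coreRadius i)) := by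
  have hN' : (N i : ℝ) ≠ 0 := by positivity
  have hr := (coreRadius_pos i).le
  have h0 : oscPoly (coreRadius i / N i) (N i) (coreRadius i) = 0 := by
    have := oscPoly_natCast_mul (coreRadius i / N i) (le_refl (N i))
    rwa [mul_div_cancel₀ _ hN'] at this
  have hend : coreMap N δ i (coreCenter i + coreRadius i) = coreCenter i + coreRadius i := by
    simp [coreMap, h0]
  have hstart : coreMap N δ i (coreCenter i - coreRadius i) = coreCenter i - coreRadius i := by
    have : coreCenter i - coreRadius i - coreCenter i = -coreRadius i := by ring
    rw [coreMap, this, oscPoly_neg, h0, neg_zero, mul_zero, add_zero]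
  have hm := (h.coreMap_strictMonoOn hi).monotoneOn
  rw [Real.closedBall_eq_Icc] at *
  intro x hx
  have h1 := hm (left_mem_Icc.2 (by linarith)) hx hx.1
  have h2 := hm hx (right_mem_Icc.2 (by linarith)) hx.2
  rw [hstart] at h1
  rw [hend] at h2
  exact ⟨h1, h2⟩

theorem core_bounds {i : ℕ} {x : ℝ}
    (hx : x ∈ Metric.closedBall (coreCenter (i + 1)) (coreRadius (i + 1))) : 0 < x ∧ x < 3 / 8 := by
  obtain ⟨h1, h2⟩ := core_subset i hx
  have h3 := stepStart_strictAnti.antitone (Nat.zero_le i)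
  rw [stepStart_zero] at h3
  exact ⟨(stepEnd_pos _).trans h1, by linarith⟩

theorem core_lt {i : ℕ} {x : ℝ}
    (hx : x ∈ Metric.closedBall (coreCenter (i + 2)) (coreRadius (i + 2))) : x < 1 / 8 :=
  ((core_subset (i + 1) hx).2.trans (stepStart_lt_stepEnd _)).trans_le
    (stepEnd_le_of_ne_zero (Nat.succ_ne_zero i))

theorem one_add_oscPolyDeriv_ne_one (h : IsProfile N δ φ) {i : ℕ} (hi : i ≠ 0) (hN : 1 ≤ N i)
    {x : ℝ} (hx : coreMap N δ i x = x) :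
    1 + δ i * oscPolyDeriv (coreRadius i / N i) (N i) (x - coreCenter i) ≠ 1 := by
  have hδ := (h.pos i hi).ne'
  have h1 : oscPoly (coreRadius i / N i) (N i) (x - coreCenter i) = 0 := by
    have : δ i * oscPoly (coreRadius i / N i) (N i) (x - coreCenter i) = 0 := by
      unfold coreMap at hx
      linarith
    exact (mul_eq_zero.1 this).resolve_left hδ
  have h2 := oscPolyDeriv_ne_zero (div_pos (coreRadius_pos i) (by positivity)) h1
  simpa using ⟨hδ, h2⟩

theorem evenMap_first_core (h : IsProfile N δ φ) {x : ℝ}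
    (hx : x ∈ Metric.closedBall (coreCenter 1) (coreRadius 1)) :
    evenMap φ x = 2 / 3 - coreMap N δ 1 x := by
  have h1 := h.eq_on_core 1 one_ne_zero x hx
  rw [h.evenMap_eq, abs_of_pos (core_bounds (i := 0) hx).1]
  simp only [plateauSlope, plateauOffset] at h1
  unfold coreMap
  linarith

/-- Oddness of the polynomial about `1/3` makes the core map commute with the reflection, so the two
reflections cancel in the second iterate. -/
theorem coreMap_reflect (x : ℝ) : coreMap N δ 1 (2 / 3 - x) = 2 / 3 - coreMap N δ 1 x := by
  have : 2 / 3 - x - coreCenter 1 = -(x - coreCenter 1) := by simp only [coreCenter]; ring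
  rw [coreMap, this, oscPoly_neg, coreMap]
  ring

theorem reflect_mem {x : ℝ} (hx : x ∈ Metric.closedBall (coreCenter 1) (coreRadius 1)) :
    2 / 3 - x ∈ Metric.closedBall (coreCenter 1) (coreRadius 1) := by
  rw [Real.closedBall_eq_Icc] at *
  simp only [coreCenter, coreRadius] at *
  constructor <;> linarith [hx.1, hx.2]

theorem evenMap_mapsTo_first_core (h : IsProfile N δ φ) (hN : 1 ≤ N 1) :
    MapsTo (evenMap φ) (Metric.closedBall (coreCenter 1) (coreRadius 1))
      (Metric.closedBall (coreCenter 1) (coreRadius 1)) := fun x hx => by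
  rw [h.evenMap_first_core hx]
  exact reflect_mem (h.coreMap_mapsTo one_ne_zero hN hx)

theorem iterate_two_first_core (h : IsProfile N δ φ) (hN : 1 ≤ N 1) {x : ℝ}
    (hx : x ∈ Metric.closedBall (coreCenter 1) (coreRadius 1)) :
    (evenMap φ)^[2] x = (coreMap N δ 1)^[2] x := by
  change evenMap φ (evenMap φ x) = coreMap N δ 1 (coreMap N δ 1 x)
  rw [h.evenMap_first_core (h.evenMap_mapsTo_first_core hN hx), h.evenMap_first_core hx,
    coreMap_reflect]
  ring

/-- On this core `f²` is increasing, so a periodic point is fixed by `f²`, and then by the core map.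
Its orbit is `{x, 2/3 - x}`. The slope takes the same value at both points because the polynomial's
derivative is even, so the multiplier is a power of a positive number different from `1`. -/
theorem absMultiplier_first_core (h : IsProfile N δ φ) (hN : 1 ≤ N 1) {x : ℝ}
    (hx : x ∈ Metric.closedBall (coreCenter 1) (coreRadius 1)) {n : ℕ} (hn : n ≠ 0)
    (hper : (evenMap φ)^[n] x = x) : absMultiplier (evenMap φ) n x ≠ 1 := by
  set C := Metric.closedBall (coreCenter 1) (coreRadius 1) with hC
  have hm := h.coreMap_strictMonoOn one_ne_zero
  have hmaps := h.coreMap_mapsTo one_ne_zero hN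
  have hmono : StrictMonoOn (evenMap φ)^[2] C := by
    intro y hy z hz hyz
    rw [h.iterate_two_first_core hN hy, h.iterate_two_first_core hN hz]
    exact hm (hmaps hy) (hmaps hz) (hm hy hz hyz)
  have h2 : (evenMap φ)^[2] x = x := by
    refine hmono.eq_of_iterate_eq ((h.evenMap_mapsTo_first_core hN).iterate 2) hx hn ?_
    rw [← iterate_mul, mul_comm, iterate_mul]
    exact iterate_fixed hper 2
  have hfix : coreMap N δ 1 x = x := by
    rw [h.iterate_two_first_core hN hx] at h2
    exact hm.eq_of_iterate_eq hmaps hx two_ne_zero h2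
  have hfx : evenMap φ x = 2 / 3 - x := by rw [h.evenMap_first_core hx, hfix]
  have hfx' : evenMap φ (2 / 3 - x) = x := by
    rw [h.evenMap_first_core (reflect_mem hx), coreMap_reflect, hfix]; ring
  have horb : ∀ k, (evenMap φ)^[k] x = x ∨ (evenMap φ)^[k] x = 2 / 3 - x := by
    intro k
    induction k with
    | zero => exact Or.inl rfl
    | succ k ih =>
      rw [iterate_succ_apply']
      rcases ih with ih | ih <;> rw [ih]
      · exact Or.inr hfx
      · exact Or.inl hfx'
  have hder : ∀ y ∈ C, |deriv (evenMap φ) y| =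
      1 + δ 1 * oscPolyDeriv (coreRadius 1 / N 1) (N 1) (y - coreCenter 1) := by
    intro y hy
    have h3 := h.deriv_on_core 1 one_ne_zero y hy
    rw [h.abs_deriv_evenMap, abs_of_pos (core_bounds (i := 0) hy).1]
    simp only [plateauSlope] at h3
    linarith
  have hconst : ∀ k, |deriv (evenMap φ) ((evenMap φ)^[k] x)| =
      1 + δ 1 * oscPolyDeriv (coreRadius 1 / N 1) (N 1) (x - coreCenter 1) := by
    intro k
    rcases horb k with hk | hk <;> rw [hk]
    · exact hder x hx
    · have : 2 / 3 - x - coreCenter 1 = -(x - coreCenter 1) := by simp only [coreCenter]; ring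
      rw [hder _ (reflect_mem hx), this, oscPolyDeriv_neg]
  rw [absMultiplier_eq_pow hconst, Ne,
    pow_eq_one_iff_of_nonneg (h.deriv_core_pos 1 one_ne_zero x hx).le hn]
  exact h.one_add_oscPolyDeriv_ne_one one_ne_zero hN hfix

theorem two_pow_mul_on_core (h : IsProfile N δ φ) {i : ℕ} {x : ℝ}
    (hx : x ∈ Metric.closedBall (coreCenter (i + 2)) (coreRadius (i + 2))) :
    2 ^ (i + 2) * φ |x| = 1 + coreMap N δ (i + 2) x := by
  rw [abs_of_pos (core_bounds (i := i + 1) hx).1, h.eq_on_core (i + 2) (by omega) x hx]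
  simp only [plateauSlope, plateauOffset, coreMap]
  ring

theorem core_level (h : IsProfile N δ φ) {i : ℕ} (hN : 1 ≤ N (i + 2)) {x : ℝ}
    (hx : x ∈ Metric.closedBall (coreCenter (i + 2)) (coreRadius (i + 2))) :
    2 ^ (i + 2) * φ |x| ≤ 5 / 4 := by
  rw [h.two_pow_mul_on_core hx]
  linarith [core_lt (h.coreMap_mapsTo (by omega) hN hx)]

theorem iterate_core (h : IsProfile N δ φ) {i : ℕ} (hN : 1 ≤ N (i + 2)) {x : ℝ}
    (hx : x ∈ Metric.closedBall (coreCenter (i + 2)) (coreRadius (i + 2))) :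
    (evenMap φ)^[i + 2 + 1] x = coreMap N δ (i + 2) x := by
  rw [(h.orbit_until_return (h.core_level hN hx) (i + 2) le_rfl).2.1 (by omega),
    h.two_pow_mul_on_core hx]
  ring

theorem minimalPeriod_core (h : IsProfile N δ φ) {i : ℕ} (hN : 1 ≤ N (i + 2)) {x : ℝ}
    (hx : x ∈ Metric.closedBall (coreCenter (i + 2)) (coreRadius (i + 2)))
    (hfix : coreMap N δ (i + 2) x = x) : minimalPeriod (evenMap φ) x = i + 2 + 1 := by
  have hper : IsPeriodicPt (evenMap φ) (i + 2 + 1) x := by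
    rw [IsPeriodicPt, IsFixedPt, h.iterate_core hN hx, hfix]
  refine le_antisymm (hper.minimalPeriod_le (by omega)) ?_
  by_contra hlt
  obtain ⟨k, hk⟩ := Nat.exists_eq_succ_of_ne_zero (hper.minimalPeriod_pos (by omega)).ne'
  have h1 := (h.orbit_until_return (h.core_level hN hx) k (by omega)).2.2.1 (by omega)
  have h2 := isPeriodicPt_minimalPeriod (evenMap φ) x
  rw [hk] at h2
  rw [h2.eq, abs_of_pos (core_bounds (i := i + 1) hx).1] at h1
  linarith [(core_bounds (i := i + 1) hx).2]

theorem absMultiplier_core (h : IsProfile N δ φ) {i : ℕ} (hN : 1 ≤ N (i + 2)) {x : ℝ}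
    (hx : x ∈ Metric.closedBall (coreCenter (i + 2)) (coreRadius (i + 2)))
    (hper : x ∈ periodicPts (evenMap φ)) :
    absMultiplier (evenMap φ) (minimalPeriod (evenMap φ) x) x ≠ 1 := by
  obtain ⟨n, hn, hper⟩ := hper
  have hm := h.coreMap_strictMonoOn (i := i + 2) (by omega)
  have hmaps := h.coreMap_mapsTo (i := i + 2) (by omega) hN
  have heq : EqOn (coreMap N δ (i + 2)) (evenMap φ)^[i + 2 + 1]
      (Metric.closedBall (coreCenter (i + 2)) (coreRadius (i + 2))) := fun y hy =>
    (h.iterate_core hN hy).symm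
  have hfix : coreMap N δ (i + 2) x = x := by
    rw [heq hx]
    refine (hm.congr heq).eq_of_iterate_eq (hmaps.congr heq) hx hn.ne' ?_
    rw [← iterate_mul, mul_comm, iterate_mul]
    exact iterate_fixed hper.eq _
  have h1 := h.deriv_on_core (i + 2) (by omega) x hx
  rw [h.minimalPeriod_core hN hx hfix,
    (h.orbit_until_return (h.core_level hN hx) (i + 2) le_rfl).2.2.2,
    abs_of_pos (core_bounds (i := i + 1) hx).1, h1]
  simpa only [plateauSlope, one_mul] using h.one_add_oscPolyDeriv_ne_one (by omega) hN hfix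

/-! ### Hyperbolicity of all periodic orbits. -/

theorem evenMap_iterate_zero_ne (h : IsProfile N δ φ) (n : ℕ) :
    (evenMap φ)^[n + 1] 0 = 1 ∨ (evenMap φ)^[n + 1] 0 = -1 := by
  induction n with
  | zero =>
    left
    rw [zero_add, iterate_one, h.evenMap_eq, abs_zero, h.eq_zero_of_nonpos 0 le_rfl, sub_zero]
  | succ n ih =>
    right
    rw [iterate_succ_apply']
    rcases ih with ih | ih <;> rw [ih]
    · exact h.isSmoothUnimodal.map_one
    · exact h.isSmoothUnimodal.map_neg_one

/-- The orbit may meet only the mirror image `-C` of a core. Evenness gives `x` and `|x|` the same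
later iterates, and those of `|x|` return to `C`. -/
theorem exists_iterate_mem_core (h : IsProfile N δ φ) (hN : ∀ i, 1 ≤ N i) {x : ℝ} {i : ℕ}
    (hi : i ≠ 0) (hx : |x| ∈ Metric.closedBall (coreCenter i) (coreRadius i)) :
    ∃ k, (evenMap φ)^[k] x ∈ Metric.closedBall (coreCenter i) (coreRadius i) := by
  rcases i with _ | _ | i
  · exact absurd rfl hi
  · refine ⟨0 + 1, ?_⟩
    rw [← evenMap_iterate_succ_abs]
    exact h.evenMap_mapsTo_first_core (hN 1) hx
  · refine ⟨i + 2 + 1, ?_⟩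
    rw [← evenMap_iterate_succ_abs, h.iterate_core (hN _) hx]
    exact h.coreMap_mapsTo (by omega) (hN _) hx

theorem absMultiplier_ne_one (h : IsProfile N δ φ) (hN : ∀ i, 1 ≤ N i) {x : ℝ}
    (hx : x ∈ periodicPts (evenMap φ)) :
    absMultiplier (evenMap φ) (minimalPeriod (evenMap φ) x) x ≠ 1 := by
  have hP := (minimalPeriod_pos_of_mem_periodicPts hx).ne'
  have hper : (evenMap φ)^[minimalPeriod (evenMap φ) x] x = x :=
    isPeriodicPt_minimalPeriod (evenMap φ) x
  by_cases hA : ∃ k, |(evenMap φ)^[k] x| < 3 / 8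
  · obtain ⟨k, hk⟩ := hA
    by_cases hc : ∃ m, ∃ i ≠ 0,
        |(evenMap φ)^[m] x| ∈ Metric.closedBall (coreCenter i) (coreRadius i)
    · obtain ⟨m, i, hi, hm⟩ := hc
      obtain ⟨l, hl⟩ := h.exists_iterate_mem_core hN hi hm
      rw [← iterate_add_apply] at hl
      rw [← absMultiplier_iterate hper (l + m), ← minimalPeriod_apply_iterate hx (l + m)]
      have hper' : (evenMap φ)^[l + m] x ∈ periodicPts (evenMap φ) :=
        ⟨_, Nat.pos_of_ne_zero hP,
          (isPeriodicPt_minimalPeriod (evenMap φ) x).apply_iterate (l + m)⟩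
      rcases i with _ | _ | i
      · exact absurd rfl hi
      · exact h.absMultiplier_first_core (hN 1) hl
          (minimalPeriod_pos_of_mem_periodicPts hper').ne' (isPeriodicPt_minimalPeriod _ _)
      · exact h.absMultiplier_core (hN _) hl hper'
    · push Not at hc
      rw [← absMultiplier_iterate hper k]
      refine (h.one_lt_absMultiplier _ _ hP hk ?_ ?_ ?_).ne'
      · rwa [← iterate_add_apply, add_comm, iterate_add_apply, hper]
      -- The critical point is not periodic: its orbit is `0, 1, -1, -1, …`.
      · intro m hm
        rw [← iterate_add_apply] at hm
        have h0 := (isPeriodicPt_minimalPeriod (evenMap φ) x).apply_iterate (m + k)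
        rw [hm] at h0
        obtain ⟨p, hp⟩ := Nat.exists_eq_succ_of_ne_zero hP
        rw [hp, IsPeriodicPt, IsFixedPt] at h0
        have h1 := h.evenMap_iterate_zero_ne p
        rw [h0] at h1
        norm_num at h1
      · intro m i hi
        rw [← iterate_add_apply]
        exact hc _ i hi
  · push Not at hA
    have h2 : ∀ k, |deriv (evenMap φ) ((evenMap φ)^[k] x)| = 2 := fun k => by
      rw [h.abs_deriv_evenMap, h.deriv_of_ge (hA k)]
    rw [absMultiplier_eq_pow h2]
    exact (one_lt_pow₀ one_lt_two hP).ne'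

theorem isHyperbolicPeriodicPt (h : IsProfile N δ φ) (hN : ∀ i, 1 ≤ N i) {x : ℝ}
    (hx : x ∈ Icc (-1 : ℝ) 1) (hper : x ∈ periodicPts (evenMap φ)) :
    IsHyperbolicPeriodicPt (evenMap φ) x := by
  refine ⟨hper, ?_⟩
  rw [(h.differentiable_evenMap.iterate _ x).derivWithin
    (uniqueDiffOn_Icc (by norm_num) x hx), abs_deriv_iterate h.differentiable_evenMap]
  exact h.absMultiplier_ne_one hN hper

/-! ### Counting periodic points. -/

theorem mem_perSet (h : IsProfile N δ φ) {i j : ℕ} (hj : j + 1 ≤ N (i + 1)) :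
    coreCenter (i + 1) + ((j + 1 : ℕ) : ℝ) * (coreRadius (i + 1) / N (i + 1)) ∈
      perSet (evenMap φ) (i + 2) := by
  have hN : 1 ≤ N (i + 1) := by omega
  have hN' : (0 : ℝ) < N (i + 1) := by exact_mod_cast hN
  have hr := coreRadius_pos (i + 1)
  set u : ℝ := ((j + 1 : ℕ) : ℝ) * (coreRadius (i + 1) / N (i + 1)) with hu
  have hu0 : 0 < u := by positivity
  have hur : u ≤ coreRadius (i + 1) := by
    rw [hu, mul_div_assoc', div_le_iff₀ hN', mul_comm]
    gcongr
  have hmem :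
      coreCenter (i + 1) + u ∈ Metric.closedBall (coreCenter (i + 1)) (coreRadius (i + 1)) := by
    rw [Real.closedBall_eq_Icc]
    constructor <;> linarith
  have hfix : coreMap N δ (i + 1) (coreCenter (i + 1) + u) = coreCenter (i + 1) + u := by
    rw [coreMap, add_sub_cancel_left, hu, oscPoly_natCast_mul _ hj, mul_zero, add_zero]
  obtain ⟨hb0, hb1⟩ := core_bounds hmem
  have key : minimalPeriod (evenMap φ) (coreCenter (i + 1) + u) = i + 2 := by
    rcases i with _ | i
    · have hp : IsPeriodicPt (evenMap φ) 2 (coreCenter (0 + 1) + u) := by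
        rw [IsPeriodicPt, IsFixedPt, h.iterate_two_first_core hN hmem]
        exact iterate_fixed hfix 2
      -- On the first core the centre `1/3` is itself a fixed point of `f`; the positive offset `u`
      -- excludes it, which is why the roots are indexed by `j + 1`.
      refine minimalPeriod_eq_prime (p := 2) hp fun hf => ?_
      rw [IsFixedPt, h.evenMap_first_core hmem, hfix] at hf
      simp only [coreCenter] at hf
      linarith
    · exact h.minimalPeriod_core hN hmem hfix
  refine ⟨⟨by linarith, by linarith⟩, ?_, key⟩
  rw [← minimalPeriod_pos_iff_mem_periodicPts, key]
  omega

theorem le_encard_perSet (h : IsProfile N δ φ) (i : ℕ) :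
    (N (i + 1) : ℕ∞) ≤ (perSet (evenMap φ) (i + 2)).encard := by
  set p : ℕ → ℝ := fun j =>
    coreCenter (i + 1) + ((j + 1 : ℕ) : ℝ) * (coreRadius (i + 1) / N (i + 1)) with hp
  have hinj : InjOn p (Finset.range (N (i + 1)) : Set ℕ) := by
    intro j hj k _ hjk
    have hN : 0 < N (i + 1) := (Nat.zero_le j).trans_lt (by simpa using hj)
    have hr : coreRadius (i + 1) / N (i + 1) ≠ 0 :=
      (div_pos (coreRadius_pos _) (by exact_mod_cast hN)).ne'
    have := mul_right_cancel₀ hr (add_left_cancel hjk)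
    exact Nat.succ_injective (by exact_mod_cast this)
  have hsub : p '' (Finset.range (N (i + 1)) : Set ℕ) ⊆ perSet (evenMap φ) (i + 2) := by
    rintro _ ⟨j, hj, rfl⟩
    exact h.mem_perSet (Nat.succ_le_of_lt (by simpa using hj))
  refine le_trans ?_ (encard_le_encard hsub)
  rw [hinj.encard_image, encard_coe_eq_coe_finsetCard, Finset.card_range]

end IsProfile

theorem mainTheorem10 (γ : ℕ → ℕ) (hγ : ∀ n : ℕ, 1 ≤ n → 0 < γ n) :
    ∃ f : ℝ → ℝ, IsSmoothUnimodal f ∧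
      (∀ x ∈ Icc (-1 : ℝ) 1, x ∈ periodicPts f → IsHyperbolicPeriodicPt f x) ∧
      ∀ n : ℕ, 2 ≤ n → (γ n : ℕ∞) ≤ (perSet f n).encard := by
  have hN : ∀ i, 1 ≤ γ (i + 1) := fun i => hγ (i + 1) (by omega)
  -- Core `i` carries period `i + 1`, hence the shift; the value at `i = 0` only fills an unused
  -- slot.
  obtain ⟨δ, φ, h⟩ := UnimodalProfile.exists_isProfile (N := fun i => γ (i + 1)) hN
  refine ⟨evenMap φ, h.isSmoothUnimodal, fun x hx hper => h.isHyperbolicPeriodicPt hN hx hper,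
    fun n hn => ?_⟩
  obtain ⟨i, rfl⟩ := Nat.exists_eq_add_of_le' hn
  exact h.le_encard_perSet i
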